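/- Let $\mathcal X=\mathbb R^D$. Let $u=(u_1,\dots,u_M)$ be an $\mathbb R^M$-valued process over $\mathcal X$ and $\hat A=(\hat A_{i,j})$ an $(M\times M)$-matrix-valued process over $\mathcal X$, both jointly measurable in the point of $\mathcal X$ and in the outcome. Suppose that $u_i\sim\mathcal{GP}(0,k_{u_i})$ for all $i$, that $\hat A_{i,j}\sim\mathcal{GP}(0,k_{\hat A_{i,j}})$ if $i>j$ and $\hat A_{i,j}=0$ otherwise, and that all the $u_i$ and $\hat A_{i,j}$ are mutually independent processes. For $y\colon\mathcal X\to\mathbb R^M$ put $$A(x,y)=\int_{\mathcal X}\hat A(x-z)\,y(z)\,dz ,$$ and for maps $B,C$ of pairs $(x,y)$ put $(B\circ C)(x,y)=B(x,C(\cdot,y))$ and $B\circ u=B(\cdot,u)$; let $A^0(x,y)=y(x)$ and $A^{n+1}=A\circ A^n$. Suppose that, for every $x\in\mathcal X$, the integrals $\int\hat A(x-z)\,(A^n\circ u)(z)\,dz$, $0\le n\le M-2$, almost surely exist (converge absolutely). Then, for every jointly measurable $\mathbb R^M$-valued process $g=(g_1,\dots,g_M)$ over $\mathcal X$ (possibly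 on another probability space), the following are equivalent: (1) $g$ is distributed as $\left(\sum_{n=0}^{M-1}A^n\right)\circ u$, that is, the two processes have the same law (the same finite-dimensional distributions); (2) for every $i=1,\dots,M$, $$g_i\mid g_{1:i-1}\;\sim\;\mathcal{GP}\bigl(0,\;k_{u_i}+k_{A_i}(\cdot,g_{1:i-1},\cdot,g_{1:i-1})\bigr),$$ where $$k_{A_i}(x,y_{1:i-1},x',y'_{1:i-1})=\sum_{j=1}^{i-1}\iint k_{\hat A_{i,j}}(x-z,x'-z')\,y_j(z)\,y'_j(z')\,dz\,dz' .$$ Statement (2) means that for all $x,x'$ the double integrals at $y_{1:i-1}=y'_{1:i-1}=g_{1:i-1}$ almost surely converge absolutely, and that for all finitely many points $x_1,\dots,x_N$ the conditional distribution of $(g_i(x_1),\dots,g_i(x_N))$ given the process $g_{1:i-1}$ is almost surely the centred Gaussian distribution whose covariance matrix is given by this kernel. -/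

import Mathlib

open MeasureTheory ProbabilityTheory
open scoped Matrix

noncomputable section

namespace LinEquiv

/-- The input space `ℝ^D`. -/
abbrev Inp (D : ℕ) : Type := EuclideanSpace ℝ (Fin D)

/-- Maps `A(x, y)` of a point `x` and of a whole function `y : ℝ^D → ℝ^M`, with values in `ℝ^M`. -/
abbrev PathMap (D M : ℕ) : Type := Inp D → (Inp D → Fin M → ℝ) → Fin M → ℝ

namespace PathMap

variable {D M : ℕ}

/-- The composition `(A ∘ B)(x, y) = A(x, B(·, y))`. -/
def comp (A B : PathMap D M) : PathMap D M := fun x y => A x (fun x' => B x' y)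

/-- The powers `A^n = A ∘ ⋯ ∘ A`; `A^0` is the identity map `(x, y) ↦ y(x)`. -/
def pow (A : PathMap D M) : ℕ → PathMap D M
  | 0 => fun x y => y x
  | n + 1 => comp A (pow A n)

/-- The action `A ∘ u = A(·, u)` on a function `u`. -/
def act (A : PathMap D M) (u : Inp D → Fin M → ℝ) : Inp D → Fin M → ℝ := fun x => A x u

/-- The convolution operator `(x, y) ↦ ∫ a(x - z) y(z) dz` of a matrix-valued function `a`. -/
def conv (a : Inp D → Matrix (Fin M) (Fin M) ℝ) : PathMap D M :=
  fun x y => ∫ z, a (x - z) *ᵥ y z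

end PathMap

/-- `X ∼ GP(0, k)` under `P`. -/
structure IsCenteredGP {Ω T : Type*} [MeasurableSpace Ω] (X : T → Ω → ℝ) (k : T → T → ℝ)
    (P : Measure Ω) : Prop where
  isGaussianProcess : IsGaussianProcess X P
  mean_eq_zero : ∀ t, ∫ ω, X t ω ∂P = 0
  cov_eq : ∀ s t, cov[X s, X t; P] = k s t

/-- `ν` is the Gaussian distribution on `ℝ^ι` with mean zero and covariance matrix `C`. -/
structure IsCenteredGaussian {ι : Type*} [Fintype ι] (ν : Measure (ι → ℝ)) (C : ι → ι → ℝ) :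
    Prop where
  isGaussian : IsGaussian ν
  mean_eq_zero : ∀ a, ∫ y, y a ∂ν = 0
  cov_eq : ∀ a b, cov[fun y => y a, fun y => y b; ν] = C a b

/-- `X | H ∼ GP(0, K_H)`: for all finitely many indices, the regular conditional distribution of
`X` at these indices given the random variable `H` is, almost surely, the centred Gaussian
distribution whose covariance matrix is given by the kernel `K_H`. -/
def IsCondCenteredGP {Ω T S : Type*} [MeasurableSpace Ω] [MeasurableSpace S]
    (X : T → Ω → ℝ) (H : Ω → S) (K : S → T → T → ℝ) (P : Measure Ω) [IsFiniteMeasure P] : Prop :=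
  ∀ I : Finset T, ∀ᵐ ω ∂P,
    IsCenteredGaussian (condDistrib (fun ω' => I.restrict (fun t => X t ω')) H P (H ω))
      (fun a b : I => K (H ω) a b)

variable {D M : ℕ}

/-- The components `y_{1:i-1}` of a vector-valued function `y`, i.e. those with index below `i`. -/
def past (i : Fin M) (y : Inp D → Fin M → ℝ) : Inp D → Set.Iio i → ℝ := fun x j => y x j

/-- The integrand `k_{Â_{i,j}}(x - z, x' - z') y_j(z) y'_j(z')` as a function of `(z, z')`. -/
def kernelIntegrand (kA : Fin M → Fin M → Inp D → Inp D → ℝ) (i : Fin M) (j : Set.Iio i)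
    (x : Inp D) (y : Inp D → Set.Iio i → ℝ) (x' : Inp D) (y' : Inp D → Set.Iio i → ℝ) :
    Inp D × Inp D → ℝ :=
  fun p => kA i j (x - p.1) (x' - p.2) * y p.1 j * y' p.2 j

/-- The kernel `k_{A_i}(x, y_{1:i-1}, x', y'_{1:i-1})`
`= ∑_{j < i} ∫∫ k_{Â_{i,j}}(x - z, x' - z') y_j(z) y'_j(z') dz dz'`. -/
def kernelA (kA : Fin M → Fin M → Inp D → Inp D → ℝ) (i : Fin M)
    (x : Inp D) (y : Inp D → Set.Iio i → ℝ) (x' : Inp D) (y' : Inp D → Set.Iio i → ℝ) : ℝ :=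
  ∑ j : Set.Iio i, ∫ p, kernelIntegrand kA i j x y x' y' p ∂(volume.prod volume)

end LinEquiv

end

open MeasureTheory ProbabilityTheory
open scoped Matrix ENNReal NNReal Topology

noncomputable section

/-! Write f for the process built from u and Â. Strict lower triangularity makes the Neumann sum
finite and gives almost surely f = u + A f, that is, f_i(x) = u_i(x) + ∑_{j<i} ∫ Â_{i,j}(x - z)
f_j(z) dz (`response_ae_eq`). By induction the past f_{1:i-1} is a function of the latent processes
in rows below i, hence independent of row i (`indepFun_past_response`). Conditioning on the past
therefore freezes the f_j at deterministic functions, and f_i becomes u_i plus integrals of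
independent Gaussian processes against fixed functions: a centred Gaussian process with the stated
covariance (`ae_integral_exp_condDistrib_eq`). So f satisfies (2) (`rowCondition_response`).

Condition (2) depends only on the law of the process (`RowCondition.of_map_eq`), which gives (1) ⇒
(2). Conversely, the law of the past and the conditional law of the next component determine their
joint law, so by induction on the component any two processes satisfying (2) have equal laws
(`map_eq_of_rowCondition`); applied to g and f this gives (2) ⇒ (1).

Two analytic points need care. Almost sure absolute convergence is assumed only pathwise, whereas
Fubini and the covariance formula need ∫ ‖Z_z‖_{L²} dz < ∞. For centred Gaussian marginals the
former implies the latter (`lintegral_eLpNorm_lt_top_of_gaussianReal`), and then the integral lies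
in the closed Gaussian subspace of L² (`integral_mem_of_isClosed`). Moreover, evaluation (x, path) ↦
path(x) need not be jointly measurable for the product σ-algebra on path space. It is replaced by a
jointly measurable version that agrees almost surely at each point (`exists_measurable_factor`), and
hence at almost every point of almost every path, which is all that integrals see. -/

namespace LinEquiv

/-! ### Jointly measurable factorization through a random variable. -/

section Factorization

/-- A jointly measurable function is jointly measurable with respect to a countably generated
sub-σ-algebra in the second variable. -/
lemma exists_countablyGenerated_measurable {X Ω : Type*} [mX : MeasurableSpace X]
    [mΩ : MeasurableSpace Ω] {f : X × Ω → ℝ} (hf : Measurable f) :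
    ∃ m : MeasurableSpace Ω, m ≤ mΩ ∧ @MeasurableSpace.CountablyGenerated Ω m ∧
      Measurable[mX.prod m] f := by
  -- Each measurable set of the product involves only countably many measurable sets of Ω: this
  -- holds for rectangles and survives complements and countable unions.
  have key : ∀ E : Set (X × Ω), MeasurableSet E → ∃ b : Set (Set Ω), b.Countable ∧
      (∀ s ∈ b, MeasurableSet s) ∧ MeasurableSet[mX.prod (.generateFrom b)] E := by
    have mono : ∀ {b c : Set (Set Ω)}, b ⊆ c →
        mX.prod (.generateFrom b) ≤ mX.prod (.generateFrom c) := fun h ↦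
      sup_le_sup le_rfl (MeasurableSpace.comap_mono (MeasurableSpace.generateFrom_mono h))
    intro E hE
    rw [← generateFrom_prod] at hE
    induction E, hE using MeasurableSpace.generateFrom_induction with
    | hC t ht _ =>
      obtain ⟨A, hA, B, hB, rfl⟩ := ht
      refine ⟨{B}, Set.countable_singleton _, by simpa using hB, ?_⟩
      exact @MeasurableSet.prod _ _ mX (.generateFrom {B}) _ _ hA
        (MeasurableSpace.measurableSet_generateFrom rfl)
    | empty => exact ⟨∅, Set.countable_empty, by simp, @MeasurableSet.empty _ (_)⟩
    | compl t _ ih =>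
      obtain ⟨b, h1, h2, h3⟩ := ih
      exact ⟨b, h1, h2, h3.compl⟩
    | iUnion s _ ih =>
      choose b h1 h2 h3 using ih
      refine ⟨⋃ n, b n, Set.countable_iUnion h1, ?_, ?_⟩
      · intro s hs
        obtain ⟨n, hn⟩ := Set.mem_iUnion.1 hs
        exact h2 n s hn
      · exact MeasurableSet.iUnion fun n ↦ mono (Set.subset_iUnion b n) _ (h3 n)
  choose! b h1 h2 h3 using key
  have hq : ∀ q : ℚ, MeasurableSet (f ⁻¹' Set.Iio (q : ℝ)) := fun q ↦ hf measurableSet_Iio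
  refine ⟨.generateFrom (⋃ q : ℚ, b (f ⁻¹' Set.Iio (q : ℝ))), ?_, ?_, ?_⟩
  · refine MeasurableSpace.generateFrom_le fun s hs ↦ ?_
    obtain ⟨q, hn⟩ := Set.mem_iUnion.1 hs
    exact h2 _ (hq q) s hn
  · exact @MeasurableSpace.CountablyGenerated.mk _ (_)
      ⟨_, Set.countable_iUnion fun q ↦ h1 _ (hq q), rfl⟩
  -- The rational half-lines generate the Borel sets, so countably many preimages control all of f.
  · rw [BorelSpace.measurable_eq (α := ℝ), Real.borel_eq_generateFrom_Iio_rat]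
    refine @measurable_generateFrom _ _ (_) _ _ fun t ht ↦ ?_
    obtain ⟨q, rfl⟩ := Set.mem_iUnion.1 ht
    exact sup_le_sup le_rfl (MeasurableSpace.comap_mono (MeasurableSpace.generateFrom_mono
      (Set.subset_iUnion (fun q : ℚ ↦ b (f ⁻¹' Set.Iio (q : ℝ))) q))) _ (h3 _ (hq q))

/-- For a countably generated σ-algebra L¹ is second countable, so the set of sections has a
countable dense subset, each member of which is the section at some point of X. -/
lemma exists_seq_lintegral_sub_lt_of_countablyGenerated {X Ω : Type*} [MeasurableSpace X]
    [Nonempty X] [MeasurableSpace Ω] [MeasurableSpace.CountablyGenerated Ω] (P : Measure Ω)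
    [IsFiniteMeasure P] {f : X × Ω → ℝ} (hf : Measurable f) {C : ℝ} (hC : ∀ p, |f p| ≤ C) :
    ∃ s : ℕ → X, ∀ x, ∀ ε : ℝ≥0∞, 0 < ε → ∃ n, ∫⁻ ω, ‖f (x, ω) - f (s n, ω)‖ₑ ∂P < ε := by
  have hmem : ∀ x, MemLp (fun ω ↦ f (x, ω)) 1 P := fun x ↦
    MemLp.of_bound (hf.comp measurable_prodMk_left).aestronglyMeasurable C
      (Filter.Eventually.of_forall fun ω ↦ hC _)
  let T : X → Lp ℝ 1 P := fun x ↦ (hmem x).toLp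
  have : Nonempty (Set.range T) := ⟨⟨_, Set.mem_range_self (Classical.arbitrary X)⟩⟩
  have : Fact ((1 : ℝ≥0∞) ≠ ∞) := ⟨by simp⟩
  have : SecondCountableTopology (Lp ℝ 1 P) := inferInstance
  choose s hs using fun n ↦ (TopologicalSpace.denseSeq (Set.range T) n).2
  refine ⟨s, fun x ε hε ↦ ?_⟩
  obtain ⟨n, hn⟩ := (TopologicalSpace.denseRange_denseSeq (Set.range T)).exists_mem_open
    (Metric.isOpen_eball (x := (⟨T x, Set.mem_range_self x⟩ : Set.range T)) (ε := ε))
    ⟨_, Metric.mem_eball_self hε⟩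
  refine ⟨n, ?_⟩
  rw [Metric.mem_eball, edist_comm, Subtype.edist_eq, ← hs n] at hn
  simpa [T, Lp.edist_toLp_toLp, eLpNorm_one_eq_lintegral_enorm] using hn

/-- The sections of a bounded jointly measurable function form a separable subset of `L¹`. -/
lemma exists_seq_lintegral_sub_lt {X Ω : Type*} [MeasurableSpace X] [Nonempty X]
    [mΩ : MeasurableSpace Ω] (P : Measure Ω) [IsFiniteMeasure P] {f : X × Ω → ℝ}
    (hf : Measurable f) {C : ℝ} (hC : ∀ p, |f p| ≤ C) :
    ∃ s : ℕ → X, ∀ x, ∀ ε : ℝ≥0∞, 0 < ε → ∃ n, ∫⁻ ω, ‖f (x, ω) - f (s n, ω)‖ₑ ∂P < ε := by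
  obtain ⟨m, hm, hcg, hfm⟩ := exists_countablyGenerated_measurable hf
  obtain ⟨s, hs⟩ := @exists_seq_lintegral_sub_lt_of_countablyGenerated X Ω _ _ m hcg (P.trim hm)
    _ f hfm C hC
  refine ⟨s, fun x ε hε ↦ (hs x ε hε).imp fun n hn ↦ ?_⟩
  rwa [lintegral_trim hm] at hn
  have hx : ∀ x, Measurable[m] fun ω ↦ f (x, ω) := fun x ↦
    hfm.comp (@measurable_prodMk_left _ _ _ m x)
  have hd : Measurable[m] fun ω ↦ f (x, ω) - f (s n, ω) := (hx x).sub (hx (s n))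
  exact hd.enorm

/-- If every member of a jointly measurable process is almost surely a measurable function of the
random variable `H`, then these functions of `H` can be chosen jointly measurable. -/
theorem exists_measurable_factor {X Ω S : Type*} [MeasurableSpace X] [MeasurableSpace Ω]
    [MeasurableSpace S] (P : Measure Ω) [IsFiniteMeasure P] {Y : X → Ω → ℝ}
    (hY : Measurable fun p : X × Ω ↦ Y p.1 p.2) {H : Ω → S}
    (h : ∀ x, ∃ p : S → ℝ, Measurable p ∧ Y x =ᵐ[P] fun ω ↦ p (H ω)) :
    ∃ e : X → S → ℝ, Measurable (fun p : X × S ↦ e p.1 p.2) ∧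
      ∀ x, Y x =ᵐ[P] fun ω ↦ e x (H ω) := by
  rcases isEmpty_or_nonempty X with hX | hX
  · exact ⟨fun _ _ ↦ 0, measurable_const, fun x ↦ hX.elim x⟩
  -- Y need not be integrable. Its arctangent is bounded, so the L¹ approximation applies, and tan
  -- undoes the change at the end.
  let b : X × Ω → ℝ := fun p ↦ Real.arctan (Y p.1 p.2)
  have hb : Measurable b := Real.measurable_arctan.comp hY
  obtain ⟨s, hs⟩ := exists_seq_lintegral_sub_lt P hb (C := Real.pi / 2)
    fun p ↦ abs_le.2 ⟨(Real.neg_pi_div_two_lt_arctan _).le, (Real.arctan_lt_pi_div_two _).le⟩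
  choose p hpm hp using h
  -- Summable errors turn L¹ approximation into almost sure convergence without passing to
  -- subsequences that would depend on x.
  let δ : ℕ → ℝ≥0∞ := fun n ↦ (2⁻¹ : ℝ≥0∞) ^ n
  have hδ : ∀ n, 0 < δ n := fun n ↦ ENNReal.pow_pos (by simp) n
  have hex : ∀ n x, ∃ k, ∫⁻ ω, ‖b (x, ω) - b (s k, ω)‖ₑ ∂P < δ n := fun n x ↦ hs x _ (hδ n)
  classical
  -- Taking the least admissible index makes the choice measurable in x.
  let K : ℕ → X → ℕ := fun n x ↦ Nat.find (hex n x)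
  have hK : ∀ n, Measurable (K n) := fun n ↦ measurable_find _ fun k ↦ by
    refine measurableSet_lt (Measurable.lintegral_prod_right' (f := fun q : X × Ω ↦
      ‖b (q.1, q.2) - b (s k, q.2)‖ₑ) ?_) measurable_const
    exact ((hb.comp measurable_id).sub
      (hb.comp (measurable_const.prodMk measurable_snd))).enorm
  let E : ℕ → X × S → ℝ := fun n q ↦ p (s (K n q.1)) q.2
  have hE : ∀ n, Measurable (E n) := fun n ↦ by
    have h1 : Measurable fun q : ℕ × S ↦ p (s q.1) q.2 :=
      measurable_from_prod_countable_right fun k ↦ hpm (s k)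
    exact h1.comp (((hK n).comp measurable_fst).prodMk measurable_snd)
  refine ⟨fun x y ↦ Filter.limsup (fun n ↦ E n (x, y)) Filter.atTop, Measurable.limsup hE,
    fun x ↦ ?_⟩
  have h1 : ∀ᵐ ω ∂P, ∑' n, ‖b (x, ω) - b (s (K n x), ω)‖ₑ < ∞ := by
    have hm : ∀ n, AEMeasurable (fun ω ↦ ‖b (x, ω) - b (s (K n x), ω)‖ₑ) P := fun n ↦
      ((hb.comp measurable_prodMk_left).sub (hb.comp measurable_prodMk_left)).enorm.aemeasurable
    refine ae_lt_top' (AEMeasurable.tsum hm) ?_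
    rw [lintegral_tsum hm]
    refine ((ENNReal.tsum_le_tsum fun n ↦ (Nat.find_spec (hex n x)).le).trans_lt ?_).ne
    simp [δ, ENNReal.tsum_geometric]
  filter_upwards [h1, ae_all_iff.2 fun n ↦ hp (s (K n x))] with ω hω1 hω2
  have h2 := ENNReal.tendsto_atTop_zero_of_tsum_ne_top hω1.ne
  have h3 : Filter.Tendsto (fun n ↦ b (s (K n x), ω)) Filter.atTop (𝓝 (b (x, ω))) := by
    rw [tendsto_iff_edist_tendsto_0]
    simpa only [edist_comm, edist_eq_enorm_sub] using h2
  have h4 : Filter.Tendsto (fun n ↦ Y (s (K n x)) ω) Filter.atTop (𝓝 (Y x ω)) := by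
    have := ((Real.continuousAt_tan.2 (Real.cos_arctan_pos (Y x ω)).ne').tendsto.comp h3)
    simpa [b, Function.comp_def] using this
  refine (Filter.Tendsto.limsup_eq ?_).symm
  refine h4.congr fun n ↦ hω2 n

/-- The pathwise version of a family of almost sure equalities of jointly measurable processes. -/
lemma ae_ae_eq_of_forall_ae_eq {X Ω : Type*} [MeasurableSpace X] [MeasurableSpace Ω]
    {μ : Measure X} [SFinite μ] {P : Measure Ω} [SFinite P] {Y Z : X → Ω → ℝ}
    (hY : Measurable fun p : X × Ω ↦ Y p.1 p.2) (hZ : Measurable fun p : X × Ω ↦ Z p.1 p.2)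
    (h : ∀ x, Y x =ᵐ[P] Z x) : ∀ᵐ ω ∂P, ∀ᵐ x ∂μ, Y x ω = Z x ω := by
  rw [← Measure.ae_ae_comm (p := fun x ω ↦ Y x ω = Z x ω) (measurableSet_eq_fun hY hZ)]
  exact Filter.Eventually.of_forall h

end Factorization

/-! ### From pathwise integrability to integrable standard deviations. -/

section Gaussian

variable {X Ω : Type*} [MeasurableSpace X] [MeasurableSpace Ω]

/-- The truncation at 1 is what makes this constant useful: removing an event of probability at most
half of it leaves at least half of the expectation. -/
lemma lintegral_min_enorm_gaussianReal_ne_zero :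
    ∫⁻ x, min ‖x‖ₑ 1 ∂(gaussianReal 0 1) ≠ 0 := by
  have : NullSingletonClass (gaussianReal 0 1) := nullSingletonClass_gaussianReal one_ne_zero
  rw [Ne, lintegral_eq_zero_iff (by fun_prop)]
  intro h
  have h0 : ∀ᵐ x ∂(gaussianReal 0 1), x ∈ ({0} : Set ℝ) := by
    filter_upwards [h] with x hx
    simpa using hx
  have h1 : gaussianReal 0 1 ({0} : Set ℝ) = 1 := by
    rw [← prob_compl_eq_zero_iff (measurableSet_singleton _)]
    exact h0
  rw [measure_singleton] at h1
  exact zero_ne_one h1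

/-- If a process with centred Gaussian marginals almost surely has integrable paths, then its
standard deviation is integrable. -/
theorem lintegral_eLpNorm_lt_top_of_gaussianReal {μ : Measure X} [SFinite μ] {P : Measure Ω}
    [IsProbabilityMeasure P] {Z : X → Ω → ℝ} (hZ : Measurable fun p : X × Ω ↦ Z p.1 p.2)
    {v : X → ℝ≥0} (hv : ∀ x, P.map (Z x) = gaussianReal 0 (v x))
    (hint : ∀ᵐ ω ∂P, ∫⁻ x, ‖Z x ω‖ₑ ∂μ < ∞) :
    ∫⁻ x, eLpNorm (Z x) 2 P ∂μ < ∞ := by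
  have hZx : ∀ x, Measurable (Z x) := fun x ↦ hZ.comp measurable_prodMk_left
  set c : ℝ≥0∞ := ∫⁻ x, min ‖x‖ₑ 1 ∂(gaussianReal 0 1) with hc
  have hc0 : c ≠ 0 := lintegral_min_enorm_gaussianReal_ne_zero
  have hc1 : c ≤ 1 := by
    calc c ≤ ∫⁻ _, 1 ∂(gaussianReal 0 1) := lintegral_mono fun x ↦ min_le_right _ _
      _ = 1 := by simp
  have hct : c ≠ ∞ := (hc1.trans_lt ENNReal.one_lt_top).ne
  let J : Ω → ℝ≥0∞ := fun ω ↦ ∫⁻ x, ‖Z x ω‖ₑ ∂μ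
  have hJ : Measurable J := Measurable.lintegral_prod_left' (f := fun p : X × Ω ↦ ‖Z p.1 p.2‖ₑ)
    hZ.enorm
  -- J is almost surely finite, so its tails tend to 0. One event {J ≤ R} then serves for all x at
  -- once.
  obtain ⟨R, hR⟩ : ∃ R : ℕ, P {ω | (R : ℝ≥0∞) < J ω} < c / 2 := by
    have ht := tendsto_measure_iInter_atTop (μ := P) (s := fun n : ℕ ↦ {ω | (n : ℝ≥0∞) < J ω})
      (fun n ↦ (measurableSet_lt measurable_const hJ).nullMeasurableSet)
      (fun m n hmn ω hω ↦ lt_of_le_of_lt (b := (n : ℝ≥0∞)) (Nat.cast_le.2 hmn) hω)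
      ⟨0, measure_ne_top _ _⟩
    have h0 : P (⋂ n : ℕ, {ω | (n : ℝ≥0∞) < J ω}) = 0 := by
      refine measure_mono_null (fun ω hω ↦ ?_) (ae_iff.1 hint)
      simp only [Set.mem_iInter, Set.mem_ofPred_eq] at hω
      simp only [Set.mem_ofPred_eq, not_lt, top_le_iff]
      by_contra h
      obtain ⟨n, hn⟩ := ENNReal.exists_nat_gt h
      exact lt_asymm hn (hω n)
    rw [h0] at ht
    exact (ht.eventually_lt_const (ENNReal.half_pos hc0)).exists
  let B : Set Ω := {ω | J ω ≤ R}
  have hB : MeasurableSet B := measurableSet_le hJ measurable_const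
  have hBc : P Bᶜ ≤ c / 2 := by
    refine le_of_eq_of_le (congrArg P ?_) hR.le
    ext ω; simp [B]
  let κ : ℝ≥0∞ := eLpNorm id 2 (gaussianReal 0 1)
  have hκ : κ ≠ ∞ := (memLp_id_gaussianReal 2).2.ne
  -- Rescaling to the standard normal gives a lower bound, uniform in x, for the first absolute
  -- moment on B in terms of the standard deviation. Integrating over x, the right side is at most κ
  -- R P(B).
  have hstep : ∀ x, eLpNorm (Z x) 2 P * (c / 2) ≤ κ * ∫⁻ ω in B, ‖Z x ω‖ₑ ∂P := by
    intro x
    set σ : ℝ := Real.sqrt (v x) with hσ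
    have hσ2 : σ ^ 2 = v x := Real.sq_sqrt (v x).2
    rcases eq_or_ne (v x) 0 with h0 | h0
    · have hz : Z x =ᵐ[P] 0 := by
        have h1 := hv x
        rw [h0, gaussianReal_zero_var] at h1
        have : ∀ᵐ y ∂(P.map (Z x)), y = 0 := by rw [h1, ae_dirac_eq]; simp
        exact ae_of_ae_map (hZx x).aemeasurable this
      rw [eLpNorm_congr_ae hz]
      simp
    have hσ0 : σ ≠ 0 := by
      intro h
      rw [h] at hσ2
      exact h0 (by exact_mod_cast (by simpa using hσ2.symm : (v x : ℝ) = 0))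
    have hstd : P.map (fun ω ↦ Z x ω / σ) = gaussianReal 0 1 := by
      have h1 : P.map (fun ω ↦ Z x ω / σ) = (P.map (Z x)).map (· / σ) := by
        rw [Measure.map_map (by fun_prop) (hZx x)]; rfl
      rw [h1, hv, gaussianReal_map_div_const]
      congr 1
      · simp
      · ext; simp [hσ2, h0]
    have hn : eLpNorm (Z x) 2 P = ‖σ‖ₑ * κ := by
      have h1 : Z x = σ • (fun ω ↦ Z x ω / σ) := by
        ext ω; simp [mul_div_cancel₀ _ hσ0]
      have h2 : κ = eLpNorm (fun ω ↦ Z x ω / σ) 2 P := by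
        simp only [κ]
        rw [← hstd, eLpNorm_map_measure (by fun_prop) ((hZx x).div_const _).aemeasurable]
        rfl
      rw [h2]
      conv_lhs => rw [h1]
      rw [eLpNorm_const_smul]
    have hmain : c / 2 ≤ ∫⁻ ω in B, ‖Z x ω / σ‖ₑ ∂P := by
      have h1 : c = ∫⁻ ω, min ‖Z x ω / σ‖ₑ 1 ∂P := by
        rw [hc, ← hstd, lintegral_map (by fun_prop) ((hZx x).div_const _)]
      have h2 : c ≤ ∫⁻ ω in B, ‖Z x ω / σ‖ₑ ∂P + c / 2 := by
        calc c = ∫⁻ ω in B, min ‖Z x ω / σ‖ₑ 1 ∂P + ∫⁻ ω in Bᶜ, min ‖Z x ω / σ‖ₑ 1 ∂P := by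
              rw [lintegral_add_compl _ hB]; exact h1
          _ ≤ ∫⁻ ω in B, ‖Z x ω / σ‖ₑ ∂P + ∫⁻ ω in Bᶜ, 1 ∂P :=
              add_le_add (lintegral_mono fun _ ↦ min_le_left _ _)
                (lintegral_mono fun _ ↦ min_le_right _ _)
          _ ≤ _ := by
              gcongr
              simpa using hBc
      have h3 : c / 2 + c / 2 ≤ ∫⁻ ω in B, ‖Z x ω / σ‖ₑ ∂P + c / 2 := by
        rwa [ENNReal.add_halves]
      exact (ENNReal.add_le_add_iff_right (by finiteness)).1 h3
    calc eLpNorm (Z x) 2 P * (c / 2) = κ * (‖σ‖ₑ * (c / 2)) := by rw [hn]; ring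
      _ ≤ κ * (‖σ‖ₑ * ∫⁻ ω in B, ‖Z x ω / σ‖ₑ ∂P) := by gcongr
      _ = κ * ∫⁻ ω in B, ‖Z x ω‖ₑ ∂P := by
        rw [← lintegral_const_mul _ ((hZx x).div_const _).enorm]
        congr 1
        refine lintegral_congr fun ω ↦ ?_
        rw [← enorm_mul, mul_div_cancel₀ _ hσ0]
  have hfin : (∫⁻ x, eLpNorm (Z x) 2 P ∂μ) * (c / 2) < ∞ := by
    calc (∫⁻ x, eLpNorm (Z x) 2 P ∂μ) * (c / 2)
        = ∫⁻ x, eLpNorm (Z x) 2 P * (c / 2) ∂μ := by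
          rw [lintegral_mul_const' _ _ (by finiteness)]
      _ ≤ ∫⁻ x, κ * ∫⁻ ω in B, ‖Z x ω‖ₑ ∂P ∂μ := lintegral_mono hstep
      _ = κ * ∫⁻ x, ∫⁻ ω in B, ‖Z x ω‖ₑ ∂P ∂μ := lintegral_const_mul' _ _ hκ
      _ = κ * ∫⁻ ω in B, J ω ∂P := by
          rw [lintegral_lintegral_swap (f := fun x ω ↦ ‖Z x ω‖ₑ) hZ.enorm.aemeasurable]
      _ ≤ κ * ∫⁻ ω in B, R ∂P := by
          gcongr κ * ?_
          exact setLIntegral_mono measurable_const fun ω hω ↦ hω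
      _ < ∞ := by
          rw [setLIntegral_const]
          finiteness
  by_contra h
  rw [not_lt, top_le_iff] at h
  rw [h, ENNReal.top_mul (by simpa using hc0)] at hfin
  exact lt_irrefl _ hfin

end Gaussian

/-! ### Closed Gaussian subspaces of L² and integrals of L²-valued processes. -/

section GaussianSpace

variable {Ω : Type*} [MeasurableSpace Ω] {P : Measure Ω}

lemma norm_exp_mul_I_sub_exp_mul_I_le (a b : ℝ) :
    ‖Complex.exp (a * Complex.I) - Complex.exp (b * Complex.I)‖ ≤ |a - b| := by
  have h : Complex.exp (a * Complex.I) - Complex.exp (b * Complex.I)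
      = Complex.exp (b * Complex.I) * (Complex.exp (Complex.I * ((a - b : ℝ) : ℂ)) - 1) := by
    rw [mul_sub, ← Complex.exp_add, mul_one]
    congr 2
    push_cast
    ring
  rw [h, norm_mul, Complex.norm_exp_ofReal_mul_I, one_mul]
  exact Real.norm_exp_I_mul_ofReal_sub_one_le

lemma integrable_exp_mul_I [IsFiniteMeasure P] {f : Ω → ℝ} (hf : AEStronglyMeasurable f P) :
    Integrable (fun ω ↦ Complex.exp (f ω * Complex.I)) P := by
  refine Integrable.of_bound (C := 1) ?_ (Filter.Eventually.of_forall fun ω ↦ ?_)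
  · exact (Complex.continuous_exp.comp
      (Complex.continuous_ofReal.mul continuous_const)).comp_aestronglyMeasurable hf
  · rw [Complex.norm_exp_ofReal_mul_I]

/-- The map is 1-Lipschitz, since s ↦ exp(is) is and the L¹ norm is at most the L² norm. This lets
Gaussian characteristic functions pass to L² limits. -/
lemma continuous_integral_exp_mul_I [IsProbabilityMeasure P] :
    Continuous fun f : Lp ℝ 2 P ↦ ∫ ω, Complex.exp (f ω * Complex.I) ∂P := by
  refine (LipschitzWith.of_dist_le_mul (K := 1) fun f g ↦ ?_).continuous
  rw [dist_eq_norm, ← integral_sub (integrable_exp_mul_I (Lp.aestronglyMeasurable f))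
    (integrable_exp_mul_I (Lp.aestronglyMeasurable g)), NNReal.coe_one, one_mul]
  have hint : Integrable (f - g : Lp ℝ 2 P) P :=
    memLp_one_iff_integrable.1 ((Lp.memLp (f - g)).mono_exponent (by norm_num))
  calc ‖∫ ω, (Complex.exp (f ω * Complex.I) - Complex.exp (g ω * Complex.I)) ∂P‖
      ≤ ∫ ω, ‖(f - g : Lp ℝ 2 P) ω‖ ∂P := by
        refine norm_integral_le_of_norm_le hint.norm ?_
        filter_upwards [Lp.coeFn_sub f g] with ω hω
        rw [hω]
        exact norm_exp_mul_I_sub_exp_mul_I_le _ _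
    _ = (eLpNorm (f - g : Lp ℝ 2 P) 1 P).toReal := by
        rw [integral_norm_eq_lintegral_enorm hint.1, eLpNorm_one_eq_lintegral_enorm]
    _ ≤ (eLpNorm (f - g : Lp ℝ 2 P) 2 P).toReal :=
        ENNReal.toReal_mono (Lp.memLp (f - g)).2.ne
          (eLpNorm_le_eLpNorm_of_exponent_le (by norm_num) (Lp.aestronglyMeasurable _))
    _ = dist f g := by rw [dist_eq_norm, Lp.norm_def]

lemma norm_sq_eq_integral_sq (f : Lp ℝ 2 P) : ‖f‖ ^ 2 = ∫ ω, f ω ^ 2 ∂P := by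
  rw [← real_inner_self_eq_norm_sq, L2.inner_def]
  refine integral_congr_ae (Filter.Eventually.of_forall fun ω ↦ ?_)
  simp [sq]

/-- The characteristic function of a member of the closed linear span of a centred Gaussian
process. -/
theorem integral_exp_mul_I_eq_of_mem_closure [IsProbabilityMeasure P] {T : Type*} {G : T → Ω → ℝ}
    (hG : IsGaussianProcess G P) (h0 : ∀ t, ∫ ω, G t ω ∂P = 0) {f : Lp ℝ 2 P}
    (hf : f ∈ (Submodule.span ℝ
      (Set.range fun t ↦ (hG.hasGaussianLaw_eval t).memLp_two.toLp)).topologicalClosure) :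
    ∫ ω, Complex.exp (f ω * Complex.I) ∂P = Complex.exp (-(‖f‖ ^ 2 / 2 : ℝ)) := by
  have hclosed : IsClosed {f : Lp ℝ 2 P | ∫ ω, Complex.exp (f ω * Complex.I) ∂P
      = Complex.exp (-(‖f‖ ^ 2 / 2 : ℝ))} :=
    isClosed_eq continuous_integral_exp_mul_I (by fun_prop)
  -- Both sides are continuous in L², so it suffices to treat finite linear combinations, which are
  -- Gaussian by the definition of a Gaussian process.
  refine closure_minimal (fun f hf ↦ ?_) hclosed hf
  obtain ⟨c, rfl⟩ := Finsupp.mem_span_range_iff_exists_finsupp.1 hf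
  set X : Lp ℝ 2 P := c.sum fun t a ↦ a • (hG.hasGaussianLaw_eval t).memLp_two.toLp with hX
  have hae : X =ᵐ[P] fun ω ↦ ∑ t ∈ c.support, c t • G t ω := by
    have h1 : ∀ s : Finset T, ((∑ t ∈ s, c t • (hG.hasGaussianLaw_eval t).memLp_two.toLp :
        Lp ℝ 2 P) : Ω → ℝ) =ᵐ[P] fun ω ↦ ∑ t ∈ s, c t • G t ω := by
      intro s
      classical
      induction s using Finset.induction_on with
      | empty =>
        filter_upwards [Lp.coeFn_zero ℝ 2 P] with ω hω
        simp
      | insert t s hts ih =>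
        rw [Finset.sum_insert hts]
        filter_upwards [Lp.coeFn_add (c t • (hG.hasGaussianLaw_eval t).memLp_two.toLp)
          (∑ t ∈ s, c t • (hG.hasGaussianLaw_eval t).memLp_two.toLp), ih,
          Lp.coeFn_smul (c t) (hG.hasGaussianLaw_eval t).memLp_two.toLp,
          (hG.hasGaussianLaw_eval t).memLp_two.coeFn_toLp] with ω h1 h2 h3 h4
        rw [h1, Pi.add_apply, h2, h3, Pi.smul_apply, h4, Finset.sum_insert hts]
    exact h1 c.support
  have hlaw : HasGaussianLaw X P := ((hG.smul c).hasGaussianLaw_fun_sum).congr hae.symm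
  have hmean : ∫ ω, X ω ∂P = 0 := by
    rw [integral_congr_ae hae, integral_finsetSum _ fun t _ ↦
      show Integrable (fun ω ↦ c t • G t ω) P from
        (hG.hasGaussianLaw_eval t).integrable.smul (c t)]
    refine Finset.sum_eq_zero fun t _ ↦ ?_
    rw [integral_smul, h0, smul_zero]
  have h := hlaw.charFun_map_eq 1
  rw [charFun_apply_real, integral_map hlaw.aemeasurable (by fun_prop)] at h
  simp only [Set.mem_ofPred_eq]
  have hvar : Var[X; P] = ‖X‖ ^ 2 := by
    rw [variance_of_integral_eq_zero hlaw.aemeasurable hmean, norm_sq_eq_integral_sq]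
  simpa [hmean, hvar] using h

variable {X X' : Type*} [MeasurableSpace X] [MeasurableSpace X'] {μ : Measure X} {ν : Measure X'}
  {F : X → Ω → ℝ} {F' : X' → Ω → ℝ}

lemma lintegral_enorm_mul_le_eLpNorm_two {f g : Ω → ℝ} (hf : AEStronglyMeasurable f P)
    (hg : AEStronglyMeasurable g P) :
    ∫⁻ ω, ‖f ω‖ₑ * ‖g ω‖ₑ ∂P ≤ eLpNorm f 2 P * eLpNorm g 2 P := by
  have h := ENNReal.lintegral_mul_le_Lp_mul_Lq P Real.HolderConjugate.two_two hf.enorm hg.enorm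
  simpa [eLpNorm_eq_lintegral_rpow_enorm_toReal (p := 2) (by simp) (by simp)] using h

lemma measurable_eLpNorm_two [SFinite P] (hF : Measurable fun p : X × Ω ↦ F p.1 p.2) :
    Measurable fun z ↦ eLpNorm (F z) 2 P := by
  simp only [eLpNorm_eq_lintegral_rpow_enorm_toReal (p := 2) (by simp) (by simp)]
  exact (Measurable.lintegral_prod_right' (f := fun p : X × Ω ↦ ‖F p.1 p.2‖ₑ ^ (2 : ℝ≥0∞).toReal)
    (hF.enorm.pow_const _)).pow_const _

lemma ae_integrable_of_lintegral_eLpNorm_lt_top [SFinite μ] [IsProbabilityMeasure P]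
    (hF : Measurable fun p : X × Ω ↦ F p.1 p.2) (hN : ∫⁻ z, eLpNorm (F z) 2 P ∂μ < ∞) :
    ∀ᵐ ω ∂P, Integrable (fun z ↦ F z ω) μ := by
  have h1 : ∫⁻ ω, ∫⁻ z, ‖F z ω‖ₑ ∂μ ∂P < ∞ := by
    rw [lintegral_lintegral_swap (hF.comp measurable_swap).enorm.aemeasurable]
    refine lt_of_le_of_lt (lintegral_mono fun z ↦ ?_) hN
    rw [← eLpNorm_one_eq_lintegral_enorm]
    exact eLpNorm_le_eLpNorm_of_exponent_le (by norm_num)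
      (hF.comp measurable_prodMk_left).aestronglyMeasurable
  have hm : Measurable fun ω ↦ ∫⁻ z, ‖F z ω‖ₑ ∂μ :=
    Measurable.lintegral_prod_left' (f := fun p : X × Ω ↦ ‖F p.1 p.2‖ₑ) hF.enorm
  filter_upwards [ae_lt_top hm h1.ne] with ω hω
  exact ⟨(hF.comp measurable_prodMk_right).aestronglyMeasurable, hω⟩

/-- By Cauchy–Schwarz the covariance is dominated by a product of standard deviations, whose double
integral factors. -/
lemma integrable_covariance_prod [SFinite μ] [SFinite ν] [SFinite P]
    (hF : Measurable fun p : X × Ω ↦ F p.1 p.2) (hF' : Measurable fun p : X' × Ω ↦ F' p.1 p.2)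
    (hN : ∫⁻ z, eLpNorm (F z) 2 P ∂μ < ∞) (hN' : ∫⁻ z, eLpNorm (F' z) 2 P ∂ν < ∞) :
    Integrable (fun p : X × X' ↦ ∫ ω, F p.1 ω * F' p.2 ω ∂P) (μ.prod ν) := by
  have hm : Measurable fun q : (X × X') × Ω ↦ F q.1.1 q.2 * F' q.1.2 q.2 :=
    (hF.comp (by fun_prop : Measurable fun q : (X × X') × Ω ↦ (q.1.1, q.2))).mul
      (hF'.comp (by fun_prop : Measurable fun q : (X × X') × Ω ↦ (q.1.2, q.2)))
  refine ⟨hm.stronglyMeasurable.integral_prod_right.aestronglyMeasurable, ?_⟩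
  rw [hasFiniteIntegral_iff_enorm]
  calc ∫⁻ p : X × X', ‖∫ ω, F p.1 ω * F' p.2 ω ∂P‖ₑ ∂(μ.prod ν)
      ≤ ∫⁻ p : X × X', eLpNorm (F p.1) 2 P * eLpNorm (F' p.2) 2 P ∂(μ.prod ν) := by
        refine lintegral_mono fun p ↦ (enorm_integral_le_lintegral_enorm _).trans ?_
        simp only [enorm_mul]
        exact lintegral_enorm_mul_le_eLpNorm_two
          (hF.comp measurable_prodMk_left).aestronglyMeasurable
          (hF'.comp measurable_prodMk_left).aestronglyMeasurable
    _ = (∫⁻ z, eLpNorm (F z) 2 P ∂μ) * ∫⁻ z, eLpNorm (F' z) 2 P ∂ν :=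
        lintegral_prod_mul (measurable_eLpNorm_two hF).aemeasurable
          (measurable_eLpNorm_two hF').aemeasurable
    _ < ∞ := ENNReal.mul_lt_top hN hN'

/-- Minkowski's integral inequality in `L²`, qualitative form. -/
lemma memLp_two_integral [SFinite μ] [SFinite P]
    (hF : Measurable fun p : X × Ω ↦ F p.1 p.2) (hN : ∫⁻ z, eLpNorm (F z) 2 P ∂μ < ∞) :
    MemLp (fun ω ↦ ∫ z, F z ω ∂μ) 2 P := by
  refine ⟨hF.stronglyMeasurable.integral_prod_left.aestronglyMeasurable, ?_⟩
  rw [eLpNorm_lt_top_iff_lintegral_rpow_enorm_lt_top (by simp) (by simp)]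
  have hm : Measurable fun q : Ω × X × X ↦ ‖F q.2.1 q.1‖ₑ * ‖F q.2.2 q.1‖ₑ :=
    (hF.comp (by fun_prop : Measurable fun q : Ω × X × X ↦ (q.2.1, q.1))).enorm.mul
      (hF.comp (by fun_prop : Measurable fun q : Ω × X × X ↦ (q.2.2, q.1))).enorm
  calc ∫⁻ ω, ‖∫ z, F z ω ∂μ‖ₑ ^ (2 : ℝ≥0∞).toReal ∂P
      ≤ ∫⁻ ω, ∫⁻ p : X × X, ‖F p.1 ω‖ₑ * ‖F p.2 ω‖ₑ ∂(μ.prod μ) ∂P := by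
        refine lintegral_mono fun ω ↦ ?_
        have hFω : Measurable fun z ↦ ‖F z ω‖ₑ := (hF.comp measurable_prodMk_right).enorm
        rw [lintegral_prod_mul hFω.aemeasurable hFω.aemeasurable, ENNReal.toReal_ofNat,
          ENNReal.rpow_ofNat, sq]
        gcongr <;> exact enorm_integral_le_lintegral_enorm _
    _ = ∫⁻ p : X × X, ∫⁻ ω, ‖F p.1 ω‖ₑ * ‖F p.2 ω‖ₑ ∂P ∂(μ.prod μ) :=
        lintegral_lintegral_swap hm.aemeasurable
    _ ≤ ∫⁻ p : X × X, eLpNorm (F p.1) 2 P * eLpNorm (F p.2) 2 P ∂(μ.prod μ) :=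
        lintegral_mono fun p ↦ lintegral_enorm_mul_le_eLpNorm_two
          (hF.comp measurable_prodMk_left).aestronglyMeasurable
          (hF.comp measurable_prodMk_left).aestronglyMeasurable
    _ = (∫⁻ z, eLpNorm (F z) 2 P ∂μ) * ∫⁻ z, eLpNorm (F z) 2 P ∂μ :=
        lintegral_prod_mul (measurable_eLpNorm_two hF).aemeasurable
          (measurable_eLpNorm_two hF).aemeasurable
    _ < ∞ := ENNReal.mul_lt_top hN hN

lemma integral_mul_integral_eq [SFinite μ] [SFinite P]
    (hF : Measurable fun p : X × Ω ↦ F p.1 p.2) (hN : ∫⁻ z, eLpNorm (F z) 2 P ∂μ < ∞)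
    {W : Ω → ℝ} (hW : MemLp W 2 P) :
    ∫ ω, W ω * ∫ z, F z ω ∂μ ∂P = ∫ z, ∫ ω, W ω * F z ω ∂P ∂μ := by
  simp only [← integral_const_mul]
  refine integral_integral_swap ⟨?_, ?_⟩
  · exact hW.1.comp_fst.mul
      (hF.comp measurable_swap).aestronglyMeasurable
  · rw [hasFiniteIntegral_iff_enorm]
    have hm : AEMeasurable (fun q : Ω × X ↦ ‖W q.1 * F q.2 q.1‖ₑ) (P.prod μ) :=
      (hW.1.comp_fst.mul (hF.comp measurable_swap).aestronglyMeasurable).enorm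
    calc ∫⁻ q : Ω × X, ‖W q.1 * F q.2 q.1‖ₑ ∂(P.prod μ)
        = ∫⁻ z, ∫⁻ ω, ‖W ω‖ₑ * ‖F z ω‖ₑ ∂P ∂μ := by
          rw [lintegral_prod_symm _ hm]
          simp only [enorm_mul]
      _ ≤ ∫⁻ z, eLpNorm W 2 P * eLpNorm (F z) 2 P ∂μ :=
          lintegral_mono fun z ↦ lintegral_enorm_mul_le_eLpNorm_two hW.1
            (hF.comp measurable_prodMk_left).aestronglyMeasurable
      _ = eLpNorm W 2 P * ∫⁻ z, eLpNorm (F z) 2 P ∂μ := lintegral_const_mul' _ _ hW.2.ne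
      _ < ∞ := ENNReal.mul_lt_top hW.2 hN

lemma integral_integral_mul_integral_eq [SFinite μ] [SFinite ν] [SFinite P]
    (hF : Measurable fun p : X × Ω ↦ F p.1 p.2) (hF' : Measurable fun p : X' × Ω ↦ F' p.1 p.2)
    (hN : ∫⁻ z, eLpNorm (F z) 2 P ∂μ < ∞) (hN' : ∫⁻ z, eLpNorm (F' z) 2 P ∂ν < ∞)
    (hF2 : ∀ z, MemLp (F z) 2 P) :
    ∫ ω, (∫ z, F z ω ∂μ) * ∫ z, F' z ω ∂ν ∂P
      = ∫ p : X × X', ∫ ω, F p.1 ω * F' p.2 ω ∂P ∂(μ.prod ν) := by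
  rw [integral_prod _ (integrable_covariance_prod hF hF' hN hN')]
  simp only [← fun z ↦ integral_mul_integral_eq hF' hN' (hF2 z)]
  have h := integral_mul_integral_eq hF hN (memLp_two_integral hF' hN')
  simp only [mul_comm (∫ z, F' z _ ∂ν)] at h
  exact h

/-- A closed subspace is its own double orthogonal complement, and by Fubini anything orthogonal to
every F z is orthogonal to the integral. -/
lemma integral_mem_of_isClosed [SFinite μ] [IsProbabilityMeasure P]
    {K : Submodule ℝ (Lp ℝ 2 P)} (hK : IsClosed (K : Set (Lp ℝ 2 P)))
    (hF : Measurable fun p : X × Ω ↦ F p.1 p.2) (hN : ∫⁻ z, eLpNorm (F z) 2 P ∂μ < ∞)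
    (hF2 : ∀ z, MemLp (F z) 2 P) (hFK : ∀ z, (hF2 z).toLp ∈ K) :
    (memLp_two_integral hF hN).toLp ∈ K := by
  have : CompleteSpace K := hK.completeSpace_coe
  rw [← K.orthogonal_orthogonal, Submodule.mem_orthogonal]
  intro W hW
  have hW' : ∀ z, ∫ ω, W ω * F z ω ∂P = 0 := by
    intro z
    have h := (Submodule.mem_orthogonal' _ _).1 hW _ (hFK z)
    rw [L2.inner_def] at h
    rw [← h]
    refine integral_congr_ae ?_
    filter_upwards [(hF2 z).coeFn_toLp] with ω hω
    simp [hω, mul_comm]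
  rw [L2.inner_def]
  have h := integral_mul_integral_eq hF hN (Lp.memLp W)
  simp only [hW', integral_zero] at h
  rw [← h]
  refine integral_congr_ae ?_
  filter_upwards [(memLp_two_integral hF hN).coeFn_toLp] with ω hω
  simp [hω, mul_comm]

end GaussianSpace

/-! ### Convolutions of independent centred Gaussian processes. -/

section IndependentProcesses

variable {Ω ι X : Type*} [MeasurableSpace Ω] {P : Measure Ω} {V : ι → X → Ω → ℝ}
  {K : ι → X → X → ℝ}

lemma IsCenteredGP.hasGaussianLaw_eval {T : Type*} {G : T → Ω → ℝ} {k : T → T → ℝ}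
    (hG : IsCenteredGP G k P) (t : T) : HasGaussianLaw (G t) P :=
  hG.isGaussianProcess.hasGaussianLaw_eval t

lemma IsCenteredGP.integral_mul_eq {T : Type*} {G : T → Ω → ℝ} {k : T → T → ℝ}
    (hG : IsCenteredGP G k P) (s t : T) : ∫ ω, G s ω * G t ω ∂P = k s t := by
  have := hG.isGaussianProcess.isProbabilityMeasure
  rw [← hG.cov_eq s t, covariance_eq_sub
    (hG.isGaussianProcess.hasGaussianLaw_eval s).memLp_two
    (hG.isGaussianProcess.hasGaussianLaw_eval t).memLp_two]
  simp [hG.mean_eq_zero]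

lemma coeFn_sum_ae_eq {α : Type*} (s : Finset α) {f : α → Lp ℝ 2 P} {g : α → Ω → ℝ}
    (h : ∀ a, f a =ᵐ[P] g a) :
    (∑ a ∈ s, f a : Lp ℝ 2 P) =ᵐ[P] fun ω ↦ ∑ a ∈ s, g a ω := by
  filter_upwards [Lp.coeFn_fun_finsetSum s f, (Finset.eventually_all s).2 fun a _ ↦ h a]
    with ω h1 h2
  rw [h1]
  exact Finset.sum_congr rfl h2

/-- Independent Gaussian processes are jointly Gaussian. -/
lemma isGaussianProcess_of_iIndepFun [Fintype ι] (hV : ∀ s, IsGaussianProcess (V s) P)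
    (hind : iIndepFun (fun s ω x ↦ V s x ω) P) :
    IsGaussianProcess (fun p : ι × X ↦ V p.1 p.2) P where
  hasGaussianLaw I := by
    classical
    let J : Finset X := I.image Prod.snd
    have h1 : iIndepFun (fun s ω ↦ J.restrict (V s · ω)) P :=
      hind.comp (fun _ (f : X → ℝ) ↦ J.restrict f) fun _ ↦ Finset.measurable_restrict J
    let L : (ι → J → ℝ) →L[ℝ] (I → ℝ) :=
      { toFun f p := f p.1.1 ⟨p.1.2, Finset.mem_image_of_mem _ p.2⟩
        map_add' _ _ := rfl
        map_smul' _ _ := rfl }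
    exact (h1.hasGaussianLaw fun s ↦ (hV s).hasGaussianLaw _).map L

lemma integral_mul_eq_zero_of_iIndepFun (hV : ∀ s, IsCenteredGP (V s) (K s) P)
    (hind : iIndepFun (fun s ω x ↦ V s x ω) P) {s s' : ι} (hs : s ≠ s') (x x' : X) :
    ∫ ω, V s x ω * V s' x' ω ∂P = 0 := by
  have h : IndepFun (V s x) (V s' x') P :=
    (hind.indepFun hs).comp (measurable_pi_apply x) (measurable_pi_apply x')
  rw [h.integral_fun_mul_eq_mul_integral
    ((hV s).hasGaussianLaw_eval x).aemeasurable.aestronglyMeasurable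
    ((hV s').hasGaussianLaw_eval x').aemeasurable.aestronglyMeasurable, (hV s).mean_eq_zero,
    zero_mul]

variable [Sub X] {y : ι → X → ℝ}

lemma memLp_two_convolution_integrand (hV : ∀ s, IsCenteredGP (V s) (K s) P) (s : ι) (x z : X) :
    MemLp (fun ω ↦ V s (x - z) ω * y s z) 2 P :=
  ((hV s).hasGaussianLaw_eval (x - z)).memLp_two.mul_const _

variable [MeasurableSpace X] [MeasurableSub₂ X] {μ : ι → Measure X} [∀ s, SFinite (μ s)]

lemma measurable_convolution_integrand (hVm : ∀ s, Measurable fun p : X × Ω ↦ V s p.1 p.2)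
    (hy : ∀ s, Measurable (y s)) (s : ι) (x : X) :
    Measurable fun p : X × Ω ↦ V s (x - p.1) p.2 * y s p.1 :=
  ((hVm s).comp (by fun_prop : Measurable fun p : X × Ω ↦ (x - p.1, p.2))).mul
    ((hy s).comp measurable_fst)

/-- The joint characteristic function of sums of convolutions of independent centred Gaussian
processes. -/
theorem integral_exp_sum_convolution_eq [Fintype ι] [IsProbabilityMeasure P]
    (hV : ∀ s, IsCenteredGP (V s) (K s) P)
    (hVm : ∀ s, Measurable fun p : X × Ω ↦ V s p.1 p.2)
    (hind : iIndepFun (fun s ω x ↦ V s x ω) P) (hy : ∀ s, Measurable (y s))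
    {α : Type*} [Fintype α] (x : α → X)
    (hN : ∀ s a, ∫⁻ z, eLpNorm (fun ω ↦ V s (x a - z) ω * y s z) 2 P ∂(μ s) < ∞) (t : α → ℝ) :
    ∫ ω, Complex.exp ((∑ a, t a * ∑ s, ∫ z, V s (x a - z) ω * y s z ∂(μ s) : ℝ) * Complex.I) ∂P
      = Complex.exp (-((∑ a, ∑ b, t a * t b * ∑ s, ∫ p : X × X,
          K s (x a - p.1) (x b - p.2) * y s p.1 * y s p.2 ∂((μ s).prod (μ s))) / 2 : ℝ)) := by
  have hG := isGaussianProcess_of_iIndepFun (fun s ↦ IsCenteredGP.isGaussianProcess (hV s)) hind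
  set H := (Submodule.span ℝ
      (Set.range fun p ↦ (hG.hasGaussianLaw_eval p).memLp_two.toLp)).topologicalClosure
  have hm := measurable_convolution_integrand hVm hy
  have h2 : ∀ s a, MemLp (fun ω ↦ ∫ z, V s (x a - z) ω * y s z ∂(μ s)) 2 P := fun s a ↦
    memLp_two_integral (hm s (x a)) (hN s a)
  have hmem : ∀ s a, (h2 s a).toLp ∈ H := by
    intro s a
    refine integral_mem_of_isClosed (Submodule.isClosed_topologicalClosure _) (hm s (x a)) (hN s a)
      (fun z ↦ memLp_two_convolution_integrand hV s (x a) z) fun z ↦ ?_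
    have : (memLp_two_convolution_integrand (y := y) hV s (x a) z).toLp
        = y s z • (hG.hasGaussianLaw_eval (s, x a - z)).memLp_two.toLp := by
      rw [← MemLp.toLp_const_smul]
      exact MemLp.toLp_congr _ _ (Filter.Eventually.of_forall fun ω ↦ by simp [mul_comm])
    rw [this]
    exact H.smul_mem _ (subset_closure (Submodule.subset_span (Set.mem_range_self (s, x a - z))))
  -- Only the diagonal terms s = s' contribute to the squared norm of the linear combination f.
  have hcov : ∀ s s' a b, s ≠ s' → ∫ ω, (∫ z, V s (x a - z) ω * y s z ∂(μ s)) *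
      ∫ z, V s' (x b - z) ω * y s' z ∂(μ s') ∂P = 0 := by
    intro s s' a b hs
    rw [integral_integral_mul_integral_eq (hm s (x a)) (hm s' (x b)) (hN s a) (hN s' b)
      (memLp_two_convolution_integrand hV s (x a))]
    refine integral_eq_zero_of_ae (Filter.Eventually.of_forall fun p ↦ ?_)
    have := integral_mul_eq_zero_of_iIndepFun hV hind hs (x a - p.1) (x b - p.2)
    simp only [mul_mul_mul_comm _ (y s _), integral_mul_const, this, zero_mul, Pi.zero_apply]
  have hvar : ∀ s a b, ∫ ω, (∫ z, V s (x a - z) ω * y s z ∂(μ s)) *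
      ∫ z, V s (x b - z) ω * y s z ∂(μ s) ∂P
        = ∫ p : X × X, K s (x a - p.1) (x b - p.2) * y s p.1 * y s p.2 ∂((μ s).prod (μ s)) := by
    intro s a b
    rw [integral_integral_mul_integral_eq (hm s (x a)) (hm s (x b)) (hN s a) (hN s b)
      (memLp_two_convolution_integrand hV s (x a))]
    refine integral_congr_ae (Filter.Eventually.of_forall fun p ↦ ?_)
    simp only [mul_mul_mul_comm _ (y s _), integral_mul_const, (hV s).integral_mul_eq]
    ring
  let f : Lp ℝ 2 P := ∑ a, t a • ∑ s, (h2 s a).toLp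
  have hfH : f ∈ H := Submodule.sum_mem _ fun a _ ↦ H.smul_mem _ (Submodule.sum_mem _ fun s _ ↦
    hmem s a)
  have hfae : f =ᵐ[P] fun ω ↦ ∑ a, t a * ∑ s, ∫ z, V s (x a - z) ω * y s z ∂(μ s) := by
    refine coeFn_sum_ae_eq _ fun a ↦ (Lp.coeFn_smul _ _).trans ?_
    filter_upwards [coeFn_sum_ae_eq Finset.univ fun s ↦ (h2 s a).coeFn_toLp] with ω hω
    rw [Pi.smul_apply, hω, smul_eq_mul]
  have hnorm : ‖f‖ ^ 2 = ∑ a, ∑ b, t a * t b * ∑ s, ∫ p : X × X,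
          K s (x a - p.1) (x b - p.2) * y s p.1 * y s p.2 ∂((μ s).prod (μ s)) := by
    have hinner : ∀ s s' a b, inner ℝ (h2 s a).toLp (h2 s' b).toLp
        = ∫ ω, (∫ z, V s (x a - z) ω * y s z ∂(μ s)) *
      ∫ z, V s' (x b - z) ω * y s' z ∂(μ s') ∂P := by
      intro s s' a b
      rw [L2.inner_def]
      refine integral_congr_ae ?_
      filter_upwards [(h2 s a).coeFn_toLp, (h2 s' b).coeFn_toLp] with ω h h'
      rw [h, h']
      simp only [RCLike.inner_apply, conj_trivial, mul_comm]
    rw [← real_inner_self_eq_norm_sq, sum_inner]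
    refine Finset.sum_congr rfl fun a _ ↦ ?_
    rw [inner_sum]
    refine Finset.sum_congr rfl fun b _ ↦ ?_
    rw [real_inner_smul_left, real_inner_smul_right, ← mul_assoc, sum_inner]
    congr 1
    refine Finset.sum_congr rfl fun s _ ↦ ?_
    rw [inner_sum, Finset.sum_eq_single s (fun s' _ hs ↦ ?_) (by simp), hinner, hvar]
    rw [hinner, hcov s s' _ _ hs.symm]
  have h := integral_exp_mul_I_eq_of_mem_closure hG (fun p ↦ (hV p.1).mean_eq_zero p.2) hfH
  rw [hnorm] at h
  rw [← h]
  refine integral_congr_ae ?_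
  filter_upwards [hfae] with ω hω
  rw [hω]

/-- If the integral of a sum of independent centred Gaussian processes almost surely converges
absolutely, then the standard deviation of each summand is integrable. -/
theorem lintegral_eLpNorm_lt_top_of_integrable_sum [Fintype ι] [IsProbabilityMeasure P]
    {ν : Measure X} [SFinite ν] (hV : ∀ s, IsCenteredGP (V s) (K s) P)
    (hVm : ∀ s, Measurable fun p : X × Ω ↦ V s p.1 p.2)
    (hind : iIndepFun (fun s ω x ↦ V s x ω) P) (hy : ∀ s, Measurable (y s)) (x : X)
    (hint : ∀ᵐ ω ∂P, Integrable (fun z ↦ ∑ s, V s (x - z) ω * y s z) ν) (s : ι) :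
    ∫⁻ z, eLpNorm (fun ω ↦ V s (x - z) ω * y s z) 2 P ∂ν < ∞ := by
  have hm := measurable_convolution_integrand hVm hy
  have h2 := memLp_two_convolution_integrand (y := y) hV
  let Z : X → Ω → ℝ := fun z ω ↦ ∑ s, V s (x - z) ω * y s z
  have hZm : Measurable fun p : X × Ω ↦ Z p.1 p.2 := Finset.measurable_fun_sum _ fun s _ ↦ hm s x
  have hZ2 : ∀ z, MemLp (Z z) 2 P := fun z ↦ memLp_finsetSum _ fun s _ ↦ h2 s x z
  have hZind : ∀ z, iIndepFun (fun s ω ↦ V s (x - z) ω * y s z) P := fun z ↦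
    hind.comp (fun s (f : X → ℝ) ↦ f (x - z) * y s z) fun s ↦
      (measurable_pi_apply _).mul_const _
  have hmean : ∀ s z, ∫ ω, V s (x - z) ω * y s z ∂P = 0 := fun s z ↦ by
    rw [integral_mul_const, (hV s).mean_eq_zero, zero_mul]
  have hZlaw : ∀ z, HasGaussianLaw (Z z) P := fun z ↦
    (hZind z).hasGaussianLaw_fun_sum fun s ↦ by
      simpa [mul_comm] using
        ((hV s).hasGaussianLaw_eval (x - z)).fun_smul (y s z)
  have hZmean : ∀ z, ∫ ω, Z z ω ∂P = 0 := fun z ↦ by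
    rw [integral_finsetSum _ fun s _ ↦ (h2 s x z).integrable (by norm_num)]
    exact Finset.sum_eq_zero fun s _ ↦ hmean s z
  have hZfin : ∫⁻ z, eLpNorm (Z z) 2 P ∂ν < ∞ := by
    refine lintegral_eLpNorm_lt_top_of_gaussianReal hZm
      (v := fun z ↦ Var[Z z; P].toNNReal) (fun z ↦ ?_) ?_
    · rw [(hZlaw z).map_eq_gaussianReal, hZmean]
    · filter_upwards [hint] with ω hω
      exact hω.2
  refine lt_of_le_of_lt (lintegral_mono fun z ↦ ?_) hZfin
  -- Integrability is known only for the sum. Variances of independent summands add, so each is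
  -- bounded by that of the sum.
  have hvar : Var[fun ω ↦ V s (x - z) ω * y s z; P] ≤ Var[Z z; P] := by
    have h1 : Var[Z z; P] = ∑ s, Var[fun ω ↦ V s (x - z) ω * y s z; P] := by
      rw [← IndepFun.variance_sum (fun s _ ↦ h2 s x z) fun s _ s' _ hs ↦ (hZind z).indepFun hs]
      congr 1
      ext ω
      simp [Z]
    rw [h1]
    exact Finset.single_le_sum (f := fun s ↦ Var[fun ω ↦ V s (x - z) ω * y s z; P])
      (fun s _ ↦ variance_nonneg _ _) (Finset.mem_univ s)
  rw [variance_of_integral_eq_zero (h2 s x z).1.aemeasurable (hmean s z),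
    variance_of_integral_eq_zero (hZ2 z).1.aemeasurable (hZmean z)] at hvar
  rw [(h2 s x z).eLpNorm_eq_integral_rpow_norm (by simp) (by simp),
    (hZ2 z).eLpNorm_eq_integral_rpow_norm (by simp) (by simp)]
  simp only [ENNReal.toReal_ofNat, Real.rpow_ofNat, Real.norm_eq_abs, sq_abs]
  exact ENNReal.ofReal_le_ofReal (Real.rpow_le_rpow (integral_nonneg fun _ ↦ sq_nonneg _) hvar
    (by norm_num))

end IndependentProcesses

/-! ### The nilpotent convolution operator and its Neumann series. -/

section Path

variable {D M : ℕ}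

/-- The `n`-th power of the convolution operator of a strictly lower triangular function annihilates
the first `n` components. -/
lemma PathMap.pow_conv_apply_eq_zero {a : Inp D → Matrix (Fin M) (Fin M) ℝ}
    (ha : ∀ i j, i ≤ j → ∀ x, a x i j = 0) (y : Inp D → Fin M → ℝ) (n : ℕ) (x : Inp D)
    (i : Fin M) (hi : (i : ℕ) < n) : (PathMap.conv a).pow n x y i = 0 := by
  induction n generalizing x i with
  | zero => simp at hi
  | succ n ih =>
    change (∫ z, a (x - z) *ᵥ ((PathMap.conv a).pow n z y)) i = 0
    by_cases h : Integrable fun z ↦ a (x - z) *ᵥ ((PathMap.conv a).pow n z y)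
    · rw [eval_integral fun i ↦ Integrable.eval h i]
      refine integral_eq_zero_of_ae (Filter.Eventually.of_forall fun z ↦ ?_)
      simp only [Matrix.mulVec, dotProduct, Pi.zero_apply]
      refine Finset.sum_eq_zero fun j _ ↦ ?_
      rcases le_or_gt i j with hij | hij
      · rw [ha i j hij, zero_mul]
      · rw [ih z j (by have : (j : ℕ) < i := hij; omega), mul_zero]
    -- A divergent integral is 0 by convention, so the vanishing needs no convergence.
    · rw [integral_undef h, Pi.zero_apply]

/-- The truncated Neumann series solves the fixed point equation `f = y + A f`. -/
lemma PathMap.act_sum_pow_conv_eq {a : Inp D → Matrix (Fin M) (Fin M) ℝ}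
    (ha : ∀ i j, i ≤ j → ∀ x, a x i j = 0) (y : Inp D → Fin M → ℝ) (x : Inp D)
    (hint : ∀ n, n + 1 < M → Integrable fun z ↦ a (x - z) *ᵥ ((PathMap.conv a).pow n).act y z) :
    Integrable (fun z ↦ a (x - z) *ᵥ
        PathMap.act (∑ n ∈ Finset.range M, (PathMap.conv a).pow n) y z) ∧
      PathMap.act (∑ n ∈ Finset.range M, (PathMap.conv a).pow n) y x
        = y x + ∫ z, a (x - z) *ᵥ
            PathMap.act (∑ n ∈ Finset.range M, (PathMap.conv a).pow n) y z := by
  rcases M with _ | m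
  · exact ⟨Integrable.of_subsingleton_codomain, Subsingleton.elim _ _⟩
  have hsum : ∀ (N : ℕ) z, PathMap.act (∑ n ∈ Finset.range N, (PathMap.conv a).pow n) y z
      = ∑ n ∈ Finset.range N, ((PathMap.conv a).pow n).act y z := by
    intro N z
    simp [PathMap.act]
  -- Here m = M - 1. The m-th power has at most its last component nonzero, and no row of a strictly
  -- lower triangular matrix uses that component. Hence convergence is needed only for n ≤ M - 2.
  have hlast : ∀ z, a (x - z) *ᵥ ((PathMap.conv a).pow m).act y z = 0 := by
    intro z
    ext i
    rw [Matrix.mulVec, dotProduct]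
    refine Finset.sum_eq_zero fun j _ ↦ ?_
    rcases le_or_gt i j with hij | hij
    · rw [ha i j hij, zero_mul]
    · have : ((PathMap.conv a).pow m).act y z j = 0 :=
        PathMap.pow_conv_apply_eq_zero ha y m z j (by
          have : (j : ℕ) < i := hij
          have := i.2
          omega)
      rw [this, mul_zero]
  have hexp : (fun z ↦ a (x - z) *ᵥ
        PathMap.act (∑ n ∈ Finset.range (m + 1), (PathMap.conv a).pow n) y z)
      = fun z ↦ ∑ n ∈ Finset.range m, a (x - z) *ᵥ ((PathMap.conv a).pow n).act y z := by
    ext1 z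
    rw [hsum, Finset.sum_range_succ, Matrix.mulVec_add, hlast, add_zero, Matrix.mulVec_sum]
  have hint' : ∀ n ∈ Finset.range m,
      Integrable fun z ↦ a (x - z) *ᵥ ((PathMap.conv a).pow n).act y z := fun n hn ↦
    hint n (by have := Finset.mem_range.1 hn; omega)
  refine ⟨by rw [hexp]; exact integrable_finsetSum _ hint', ?_⟩
  -- Splitting off the term n = 0 leaves the powers n + 1, which are by definition the integrals of
  -- the powers n.
  rw [hexp, integral_finsetSum _ hint', hsum, Finset.sum_range_succ']
  exact add_comm _ _

variable {Ω : Type*} [MeasurableSpace Ω] {Ahat : Inp D → Ω → Matrix (Fin M) (Fin M) ℝ}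
  {u : Inp D → Ω → Fin M → ℝ}

lemma measurable_conv (hA : ∀ i j, Measurable fun p : Inp D × Ω ↦ Ahat p.1 p.2 i j)
    {y : Inp D → Ω → Fin M → ℝ} (hy : Measurable fun p : Inp D × Ω ↦ y p.1 p.2) :
    Measurable fun p : Inp D × Ω ↦ ∫ z, Ahat (p.1 - z) p.2 *ᵥ y z p.2 := by
  have hm : Measurable fun q : (Inp D × Ω) × Inp D ↦
      Ahat (q.1.1 - q.2) q.1.2 *ᵥ y q.2 q.1.2 := by
    refine measurable_pi_lambda _ fun i ↦ ?_
    simp only [Matrix.mulVec, dotProduct]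
    refine Finset.measurable_fun_sum _ fun j _ ↦ ?_
    exact ((hA i j).comp
      (by fun_prop : Measurable fun q : (Inp D × Ω) × Inp D ↦ (q.1.1 - q.2, q.1.2))).mul
      ((measurable_pi_apply j).comp (hy.comp
      (by fun_prop : Measurable fun q : (Inp D × Ω) × Inp D ↦ (q.2, q.1.2))))
  exact hm.stronglyMeasurable.integral_prod_right.measurable

lemma measurable_act_sum_pow_conv
    (hA : ∀ i j, Measurable fun p : Inp D × Ω ↦ Ahat p.1 p.2 i j)
    (hu : ∀ i, Measurable fun p : Inp D × Ω ↦ u p.1 p.2 i) :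
    Measurable fun p : Inp D × Ω ↦ PathMap.act
      (∑ n ∈ Finset.range M, (PathMap.conv fun x ↦ Ahat x p.2).pow n) (fun x ↦ u x p.2) p.1 := by
  have hpow : ∀ n, Measurable fun p : Inp D × Ω ↦
      (PathMap.conv fun x ↦ Ahat x p.2).pow n p.1 fun x ↦ u x p.2 := by
    intro n
    induction n with
    | zero => exact measurable_pi_lambda _ hu
    | succ n ih =>
      exact measurable_conv (y := fun z ω ↦ (PathMap.conv fun x ↦ Ahat x ω).pow n z fun x ↦ u x ω)
        hA ih
  simpa [PathMap.act] using Finset.measurable_fun_sum (Finset.range M) fun n _ ↦ hpow n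

end Path

/-! ### The response as a function of latent rows; independence of past and present. -/

section Factor

variable {X Ω S : Type*} [MeasurableSpace X] [MeasurableSpace Ω] [MeasurableSpace S]
  {P : Measure Ω} [IsFiniteMeasure P] {H : Ω → S}

/-- The exceptional null set of each factorization depends on x. A jointly measurable choice of
factors agrees with Y for almost every x on almost every path, so it can be integrated. -/
lemma exists_factor_integral {μ : Measure X} [SFinite μ] {Y : X → Ω → ℝ}
    (hY : Measurable fun p : X × Ω ↦ Y p.1 p.2) (hH : Measurable H)
    (h : ∀ x, ∃ p : S → ℝ, Measurable p ∧ Y x =ᵐ[P] fun ω ↦ p (H ω)) :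
    ∃ p : S → ℝ, Measurable p ∧ (fun ω ↦ ∫ x, Y x ω ∂μ) =ᵐ[P] fun ω ↦ p (H ω) := by
  obtain ⟨e, he, hYe⟩ := exists_measurable_factor P hY h
  refine ⟨fun s ↦ ∫ x, e x s ∂μ, he.stronglyMeasurable.integral_prod_left.measurable, ?_⟩
  have hm : Measurable fun p : X × Ω ↦ e p.1 (H p.2) :=
    he.comp (measurable_fst.prodMk (hH.comp measurable_snd))
  filter_upwards [ae_ae_eq_of_forall_ae_eq (μ := μ) hY hm hYe] with ω hω
  exact integral_congr_ae hω

end Factor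

section Response

variable {D M : ℕ} {Ω : Type*} [MeasurableSpace Ω] {P : Measure Ω} [IsProbabilityMeasure P]

/-- The process `(∑_{n < M} A^n) ∘ u`. -/
def response (Ahat : Inp D → Ω → Matrix (Fin M) (Fin M) ℝ) (u : Inp D → Ω → Fin M → ℝ)
    (x : Inp D) (ω : Ω) : Fin M → ℝ :=
  PathMap.act (∑ n ∈ Finset.range M, (PathMap.conv fun x ↦ Ahat x ω).pow n) (fun x ↦ u x ω) x

/-- The latent processes that enter row `i`: `u_i` and the `Â_{i,j}` for `j < i`. -/
def rowProcess (Ahat : Inp D → Ω → Matrix (Fin M) (Fin M) ℝ) (u : Inp D → Ω → Fin M → ℝ)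
    (i : Fin M) (s : Option (Set.Iio i)) (x : Inp D) (ω : Ω) : ℝ :=
  s.elim (u x ω i) fun j ↦ Ahat x ω i j

/-- The family of all latent processes. -/
def latent (Ahat : Inp D → Ω → Matrix (Fin M) (Fin M) ℝ) (u : Inp D → Ω → Fin M → ℝ)
    (s : Fin M ⊕ Fin M × Fin M) (ω : Ω) (x : Inp D) : ℝ :=
  Sum.elim (fun i ↦ u x ω i) (fun q ↦ Ahat x ω q.1 q.2) s

/-- The row in which a latent process enters. -/
def latentRow (s : Fin M ⊕ Fin M × Fin M) : Fin M := Sum.elim id Prod.fst s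

variable {Ahat : Inp D → Ω → Matrix (Fin M) (Fin M) ℝ} {u : Inp D → Ω → Fin M → ℝ}

-- The fixed point equation in coordinates. Rows sum only over j < i because the remaining entries
-- vanish, which makes the system recursive in i.
omit [IsProbabilityMeasure P] in
lemma response_ae_eq (hA_zero : ∀ i j, i ≤ j → ∀ x ω, Ahat x ω i j = 0)
    (h_conv : ∀ x, ∀ᵐ ω ∂P, ∀ n : ℕ, n + 1 < M → Integrable (fun z ↦ Ahat (x - z) ω *ᵥ
        ((PathMap.conv (fun x' ↦ Ahat x' ω)).pow n).act (fun x' ↦ u x' ω) z)) (x : Inp D) :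
    ∀ᵐ ω ∂P, ∀ i : Fin M,
      Integrable (fun z ↦ ∑ j : Set.Iio i, Ahat (x - z) ω i j * response Ahat u z ω j) ∧
      response Ahat u x ω i
        = u x ω i + ∫ z, ∑ j : Set.Iio i, Ahat (x - z) ω i j * response Ahat u z ω j := by
  filter_upwards [h_conv x] with ω hω i
  obtain ⟨h1, h2⟩ := PathMap.act_sum_pow_conv_eq (fun i j hij x ↦ hA_zero i j hij x ω) _ x hω
  have hrow : ∀ z, (Ahat (x - z) ω *ᵥ response Ahat u z ω) i
      = ∑ j : Set.Iio i, Ahat (x - z) ω i j * response Ahat u z ω j := by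
    intro z
    simp only [Matrix.mulVec, dotProduct]
    rw [← Finset.sum_subtype (Finset.univ.filter fun j ↦ j < i) (by simp)
      fun j ↦ Ahat (x - z) ω i j * response Ahat u z ω j, Finset.sum_filter]
    refine Finset.sum_congr rfl fun j _ ↦ ?_
    split_ifs with hj
    · rfl
    · rw [hA_zero i j (not_lt.1 hj), zero_mul]
  simp only [← hrow]
  refine ⟨Integrable.eval h1 i, ?_⟩
  exact (congrFun h2 i).trans
    (congrArg (u x ω i + ·) (eval_integral (fun i ↦ Integrable.eval h1 i) i))

lemma measurable_response
    (hA : ∀ i j, Measurable fun p : Inp D × Ω ↦ Ahat p.1 p.2 i j)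
    (hu : ∀ i, Measurable fun p : Inp D × Ω ↦ u p.1 p.2 i) :
    Measurable fun p : Inp D × Ω ↦ response Ahat u p.1 p.2 :=
  measurable_act_sum_pow_conv hA hu

lemma measurable_latent
    (hA : ∀ i j, Measurable fun p : Inp D × Ω ↦ Ahat p.1 p.2 i j)
    (hu : ∀ i, Measurable fun p : Inp D × Ω ↦ u p.1 p.2 i) (s : Fin M ⊕ Fin M × Fin M) :
    Measurable (latent Ahat u s) := by
  refine measurable_pi_lambda _ fun x ↦ ?_
  rcases s with i | q
  · exact (hu i).comp measurable_prodMk_left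
  · exact (hA q.1 q.2).comp measurable_prodMk_left

/-- The components of the response below `i` are functions of the latent processes in the rows
below `i`. -/
lemma exists_factor_response (hA : ∀ i j, Measurable fun p : Inp D × Ω ↦ Ahat p.1 p.2 i j)
    (hu : ∀ i, Measurable fun p : Inp D × Ω ↦ u p.1 p.2 i)
    (hA_zero : ∀ i j, i ≤ j → ∀ x ω, Ahat x ω i j = 0)
    (h_conv : ∀ x, ∀ᵐ ω ∂P, ∀ n : ℕ, n + 1 < M → Integrable (fun z ↦ Ahat (x - z) ω *ᵥ
        ((PathMap.conv (fun x' ↦ Ahat x' ω)).pow n).act (fun x' ↦ u x' ω) z))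
    {i : Fin M} {R : Finset (Fin M ⊕ Fin M × Fin M)} (hR : ∀ s, latentRow s < i → s ∈ R)
    (j : Fin M) (hj : j < i) (x : Inp D) :
    ∃ p : (R → Inp D → ℝ) → ℝ, Measurable p ∧
      (fun ω ↦ response Ahat u x ω j) =ᵐ[P] fun ω ↦ p fun s ↦ latent Ahat u s ω := by
  induction j using WellFoundedLT.induction generalizing x with
  | ind j ih =>
    choose! p hp hpe using fun (l : Set.Iio j) ↦ ih l l.2 (lt_trans l.2 hj)
    have hH : Measurable fun ω (s : R) ↦ latent Ahat u s ω :=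
      measurable_pi_lambda _ fun s ↦ measurable_latent hA hu s
    have hresp := measurable_response hA hu
    have hRm : ∀ s x, Measurable fun h : R → Inp D → ℝ ↦ h s x := fun s x ↦
      (measurable_pi_apply x).comp (measurable_pi_apply s)
    obtain ⟨q, hq, hqe⟩ := exists_factor_integral (P := P) (μ := volume)
      (Y := fun z ω ↦ ∑ l : Set.Iio j, Ahat (x - z) ω j l * response Ahat u z ω l)
      (H := fun ω (s : R) ↦ latent Ahat u s ω) (by
        refine Finset.measurable_fun_sum _ fun l _ ↦ ((hA j l).comp
          (by fun_prop : Measurable fun q : Inp D × Ω ↦ (x - q.1, q.2))).mul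
          ((measurable_pi_apply _).comp hresp)) hH (by
        intro z
        refine ⟨fun h ↦ ∑ l : Set.Iio j, h ⟨Sum.inr (j, l), hR _ hj⟩ (x - z) * p l z h, ?_, ?_⟩
        · exact Finset.measurable_fun_sum _ fun l _ ↦
            (hRm _ _).mul (hp l z)
        · filter_upwards [ae_all_iff.2 fun l ↦ hpe l z] with ω hω
          refine Finset.sum_congr rfl fun l _ ↦ ?_
          rw [hω l]
          rfl)
    refine ⟨fun h ↦ h ⟨Sum.inl j, hR _ hj⟩ x + q h,
      (hRm _ _).add hq, ?_⟩
    filter_upwards [response_ae_eq hA_zero h_conv x, hqe] with ω h1 h2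
    rw [(h1 j).2, h2]
    rfl

/-- The components of the response below `i` are independent of the latent processes in row `i`. -/
lemma indepFun_past_response (hA : ∀ i j, Measurable fun p : Inp D × Ω ↦ Ahat p.1 p.2 i j)
    (hu : ∀ i, Measurable fun p : Inp D × Ω ↦ u p.1 p.2 i)
    (hA_zero : ∀ i j, i ≤ j → ∀ x ω, Ahat x ω i j = 0)
    (h_indep : iIndepFun (latent Ahat u) P)
    (h_conv : ∀ x, ∀ᵐ ω ∂P, ∀ n : ℕ, n + 1 < M → Integrable (fun z ↦ Ahat (x - z) ω *ᵥ
        ((PathMap.conv (fun x' ↦ Ahat x' ω)).pow n).act (fun x' ↦ u x' ω) z)) (i : Fin M) :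
    IndepFun (fun ω ↦ past i fun x ↦ response Ahat u x ω)
      (fun ω s x ↦ rowProcess Ahat u i s x ω) P := by
  let R : Finset (Fin M ⊕ Fin M × Fin M) := Finset.univ.filter fun s ↦ latentRow s < i
  let T : Finset (Fin M ⊕ Fin M × Fin M) := Finset.univ.filter fun s ↦ latentRow s = i
  have hR : ∀ s, latentRow s < i → s ∈ R := fun s hs ↦ by simpa [R] using hs
  have hT : ∀ s, latentRow s = i → s ∈ T := fun s hs ↦ by simpa [T] using hs
  have hRT : Disjoint R T := Finset.disjoint_filter.2 fun s _ h h' ↦ h.ne h'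
  have hind := h_indep.indepFun_finset R T hRT fun s ↦ measurable_latent hA hu s
  choose! p hp hpe using fun j : Set.Iio i ↦
    exists_factor_response hA hu hA_zero h_conv hR (j : Fin M) j.2
  have h1 : IndepFun (fun ω (x : Inp D) (j : Set.Iio i) ↦ p j x fun s ↦ latent Ahat u s ω)
      (fun ω s x ↦ rowProcess Ahat u i s x ω) P := by
    let ψ : (T → Inp D → ℝ) → Option (Set.Iio i) → Inp D → ℝ := fun h s ↦
      s.elim (h ⟨Sum.inl i, hT _ rfl⟩) fun j ↦ h ⟨Sum.inr (i, j), hT _ rfl⟩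
    have hψ : Measurable ψ := by
      refine measurable_pi_lambda _ fun s ↦ ?_
      rcases s with _ | j <;> exact measurable_pi_apply _
    have := hind.comp (φ := fun h (x : Inp D) (j : Set.Iio i) ↦ p j x h) (ψ := ψ)
      (measurable_pi_lambda _ fun x ↦ measurable_pi_lambda _ fun j ↦ hp j x) hψ
    convert! this using 1
    ext ω s x
    rcases s with _ | j <;> rfl
  -- Equality almost surely at each fixed x suffices, as independence of processes concerns the
  -- product σ-algebra.
  refine IndepFun.process_congr_left h1 fun x ↦ ?_
  filter_upwards [ae_all_iff.2 fun j ↦ hpe j x] with ω hω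
  ext j
  exact (hω j).symm

omit [IsProbabilityMeasure P] in
lemma iIndepFun_rowProcess (h_indep : iIndepFun (latent Ahat u) P) (i : Fin M) :
    iIndepFun (fun s ω x ↦ rowProcess Ahat u i s x ω) P := by
  have h := h_indep.precomp (g := fun s : Option (Set.Iio i) ↦
    s.elim (Sum.inl i : Fin M ⊕ Fin M × Fin M) fun j ↦ Sum.inr (i, (j : Fin M))) (by
      rintro (_ | j) (_ | k) h <;> simp at h ⊢
      exact Subtype.ext h)
  convert! h using 1
  ext s ω x
  rcases s with _ | j <;> rfl

end Response

/-! ### Conditional laws given an independent variable. -/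

section Conditional

/-- Under independence the joint law is a product, so an almost sure property may be read with the
first variable frozen. -/
lemma ae_ae_of_indepFun {Ω S W : Type*} [MeasurableSpace Ω] [MeasurableSpace S]
    [MeasurableSpace W] {P : Measure Ω} [IsProbabilityMeasure P] {H : Ω → S} {V : Ω → W}
    (hH : Measurable H) (hV : Measurable V) (hHV : IndepFun H V P) {p : S × W → Prop}
    (hp : MeasurableSet {q | p q}) (h : ∀ᵐ ω ∂P, p (H ω, V ω)) :
    ∀ᵐ s ∂(P.map H), ∀ᵐ ω ∂P, p (s, V ω) := by
  have h1 : ∀ᵐ q ∂(P.map fun ω ↦ (H ω, V ω)), p q := (ae_map_iff (by fun_prop) hp).2 h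
  rw [(indepFun_iff_map_prod_eq_prod_map_map hH.aemeasurable hV.aemeasurable).1 hHV] at h1
  have : IsProbabilityMeasure (P.map V) := Measure.isProbabilityMeasure_map hV.aemeasurable
  filter_upwards [Measure.ae_ae_of_ae_prod h1] with s hs
  exact ae_of_ae_map hV.aemeasurable hs

/-- The conditional distribution of a function of two independent random variables given the
first one. -/
lemma condDistrib_ae_eq_map_of_indepFun {Ω S W E : Type*} [MeasurableSpace Ω] [MeasurableSpace S]
    [MeasurableSpace W] [MeasurableSpace E] [StandardBorelSpace E] [Nonempty E] {P : Measure Ω}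
    [IsProbabilityMeasure P] {H : Ω → S} {V : Ω → W} (hH : Measurable H) (hV : Measurable V)
    (hHV : IndepFun H V P) {Ψ : S × W → E} (hΨ : Measurable Ψ) :
    ∀ᵐ s ∂(P.map H), condDistrib (fun ω ↦ Ψ (H ω, V ω)) H P s = P.map fun ω ↦ Ψ (s, V ω) := by
  have : IsProbabilityMeasure (P.map V) := Measure.isProbabilityMeasure_map hV.aemeasurable
  -- The kernel that freezes s and draws V from its own law. Uniqueness of conditional distributions
  -- identifies it with `condDistrib`.
  let κ : Kernel S E := (Kernel.id ×ₖ Kernel.const S (P.map V)).map Ψ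
  have hκ : ∀ s, κ s = P.map fun ω ↦ Ψ (s, V ω) := by
    intro s
    rw [Kernel.map_apply _ hΨ, Kernel.prod_apply, Kernel.id_apply, Kernel.const_apply,
      Measure.dirac_prod, Measure.map_map hΨ measurable_prodMk_left,
      Measure.map_map (hΨ.comp measurable_prodMk_left) hV]
    rfl
  have hκm : IsMarkovKernel κ := Kernel.IsMarkovKernel.map _ hΨ
  have h := condDistrib_ae_eq_of_measure_eq_compProd_of_measurable (κ := κ) (μ := P) hH
    (hΨ.comp (hH.prodMk hV)) (by
      ext B hB
      rw [Measure.compProd_apply hB, Measure.map_apply (by fun_prop) hB]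
      have h1 : (fun x ↦ (H x, (Ψ ∘ fun a ↦ (H a, V a)) x)) ⁻¹' B
          = (fun ω ↦ (H ω, V ω)) ⁻¹' ((fun q : S × W ↦ (q.1, Ψ q)) ⁻¹' B) := rfl
      have hB' : MeasurableSet ((fun q : S × W ↦ (q.1, Ψ q)) ⁻¹' B) :=
        (measurable_fst.prodMk hΨ) hB
      rw [h1, ← Measure.map_apply (hH.prodMk hV) hB',
        (indepFun_iff_map_prod_eq_prod_map_map hH.aemeasurable hV.aemeasurable).1 hHV,
        Measure.prod_apply hB']
      refine lintegral_congr fun s ↦ ?_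
      rw [hκ, Measure.map_apply (by fun_prop) (measurable_prodMk_left hB),
        Measure.map_apply hV (measurable_prodMk_left hB')]
      rfl)
  filter_upwards [h] with s hs
  rw [← hκ s, ← hs]
  rfl

variable {D : ℕ} {Ω S J : Type*} [MeasurableSpace Ω] [MeasurableSpace S] [Fintype J]
  {P : Measure Ω} [IsProbabilityMeasure P] {V : Option J → Inp D → Ω → ℝ}
  {K : Option J → Inp D → Inp D → ℝ} {H : Ω → S} {y : J → Inp D → S → ℝ}

/-- Independence is a statement about paths, so integrals must be written as measurable functions of
the path. The version e replaces raw evaluation and changes the integrands only on null sets of z.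
-/
lemma exists_path_version (hVm : ∀ s, Measurable fun p : Inp D × Ω ↦ V s p.1 p.2) :
    ∃ e : Option J → Inp D → (Option J → Inp D → ℝ) → ℝ,
      (∀ s, Measurable fun p : Inp D × (Option J → Inp D → ℝ) ↦ e s p.1 p.2) ∧
      ∀ x, ∀ᵐ ω ∂P, ∀ᵐ z ∂(volume : Measure (Inp D)), ∀ s,
        V s (x - z) ω = e s (x - z) fun s x ↦ V s x ω := by
  choose e he hVe using fun s ↦ exists_measurable_factor P (hVm s)
    (H := fun ω s x ↦ V s x ω) fun x ↦ ⟨fun v ↦ v s x,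
      (measurable_pi_apply x).comp (measurable_pi_apply s), Filter.EventuallyEq.rfl⟩
  refine ⟨e, he, fun x ↦ ?_⟩
  have hpath : Measurable fun ω (s : Option J) x ↦ V s x ω :=
    measurable_pi_lambda _ fun s ↦ measurable_pi_lambda _ fun x ↦
      (hVm s).comp measurable_prodMk_left
  have h1 : ∀ s, ∀ᵐ ω ∂P, ∀ᵐ z ∂(volume : Measure (Inp D)),
      V s (x - z) ω = e s (x - z) fun s x ↦ V s x ω := fun s ↦
    ae_ae_eq_of_forall_ae_eq (Y := fun z ω ↦ V s (x - z) ω)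
      (Z := fun z ω ↦ e s (x - z) fun s x ↦ V s x ω)
      ((hVm s).comp (by fun_prop : Measurable fun p : Inp D × Ω ↦ (x - p.1, p.2)))
      ((he s).comp ((measurable_const.sub measurable_fst).prodMk (hpath.comp measurable_snd)))
      fun z ↦ hVe s (x - z)
  filter_upwards [ae_all_iff.2 h1] with ω hω
  exact ae_all_iff.2 hω

/-- Conditionally on `H`, the standard deviations of the integrands are integrable. -/
lemma ae_lintegral_eLpNorm_lt_top (hV : ∀ s, IsCenteredGP (V s) (K s) P)
    (hVm : ∀ s, Measurable fun p : Inp D × Ω ↦ V s p.1 p.2)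
    (hind : iIndepFun (fun s ω x ↦ V s x ω) P) (hH : Measurable H)
    (hHV : IndepFun H (fun ω s x ↦ V s x ω) P)
    (hy : ∀ j, Measurable fun p : Inp D × S ↦ y j p.1 p.2) (x : Inp D)
    (hint : ∀ᵐ ω ∂P, Integrable fun z ↦ ∑ j, V (some j) (x - z) ω * y j z (H ω)) :
    ∀ᵐ s ∂(P.map H), ∀ j,
      ∫⁻ z, eLpNorm (fun ω ↦ V (some j) (x - z) ω * y j z s) 2 P < ∞ := by
  obtain ⟨e, he, hVe⟩ := exists_path_version (P := P) hVm
  have hpath : Measurable fun ω (s : Option J) x ↦ V s x ω :=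
    measurable_pi_lambda _ fun s ↦ measurable_pi_lambda _ fun x ↦
      (hVm s).comp measurable_prodMk_left
  have hm : StronglyMeasurable
      (Function.uncurry fun (q : S × (Option J → Inp D → ℝ)) (z : Inp D) ↦
        ∑ j, e (some j) (x - z) q.2 * y j z q.1) := by
    refine (Finset.measurable_fun_sum _ fun j _ ↦ ?_).stronglyMeasurable
    exact ((he (some j)).comp (by fun_prop : Measurable
      fun q : (S × (Option J → Inp D → ℝ)) × Inp D ↦ (x - q.2, q.1.2))).mul
      ((hy j).comp (by fun_prop : Measurable
      fun q : (S × (Option J → Inp D → ℝ)) × Inp D ↦ (q.2, q.1.1)))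
  have h1 := ae_ae_of_indepFun hH hpath hHV (p := fun q ↦ Integrable fun z ↦
    ∑ j, e (some j) (x - z) q.2 * y j z q.1)
    (_root_.measurableSet_integrable (μ := volume) hm) (by
    filter_upwards [hint, hVe x] with ω h1 h2
    refine h1.congr ?_
    filter_upwards [h2] with z hz
    simp only [hz])
  filter_upwards [h1] with s hs
  refine lintegral_eLpNorm_lt_top_of_integrable_sum (V := fun j ↦ V (some j))
    (y := fun j z ↦ y j z s) (fun j ↦ hV (some j)) (fun j ↦ hVm (some j))
    (hind.precomp (Option.some_injective J)) (fun j ↦ (hy j).comp measurable_prodMk_right) x ?_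
  filter_upwards [hs, hVe x] with ω h1 h2
  refine h1.congr ?_
  filter_upwards [h2] with z hz
  simp only [hz]

/-- The conditional characteristic function given `H` of the sum of a Gaussian process and of the
convolutions of Gaussian processes with functions of `H`. -/
theorem ae_integral_exp_condDistrib_eq (hV : ∀ s, IsCenteredGP (V s) (K s) P)
    (hVm : ∀ s, Measurable fun p : Inp D × Ω ↦ V s p.1 p.2)
    (hind : iIndepFun (fun s ω x ↦ V s x ω) P) (hH : Measurable H)
    (hHV : IndepFun H (fun ω s x ↦ V s x ω) P)
    (hy : ∀ j, Measurable fun p : Inp D × S ↦ y j p.1 p.2) {f : Inp D → Ω → ℝ}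
    (hint : ∀ x, ∀ᵐ ω ∂P, Integrable fun z ↦ ∑ j, V (some j) (x - z) ω * y j z (H ω))
    (hf : ∀ x, ∀ᵐ ω ∂P, f x ω = V none x ω + ∫ z, ∑ j, V (some j) (x - z) ω * y j z (H ω))
    (I : Finset (Inp D)) :
    ∀ᵐ s ∂(P.map H), ∀ t : I → ℝ,
      ∫ w, Complex.exp ((∑ a, t a * w a : ℝ) * Complex.I)
        ∂(condDistrib (fun ω ↦ I.restrict fun x ↦ f x ω) H P s)
      = Complex.exp (-((∑ a, ∑ b, t a * t b * (K none a b + ∑ j, ∫ p : Inp D × Inp D,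
          K (some j) (a - p.1) (b - p.2) * y j p.1 s * y j p.2 s ∂(volume.prod volume))) / 2 : ℝ))
      := by
  obtain ⟨e, he, hVe⟩ := exists_path_version (P := P) hVm
  have hpath : Measurable fun ω (s : Option J) x ↦ V s x ω :=
    measurable_pi_lambda _ fun s ↦ measurable_pi_lambda _ fun x ↦
      (hVm s).comp measurable_prodMk_left
  let Ψ : S × (Option J → Inp D → ℝ) → I → ℝ := fun q a ↦
    q.2 none a + ∫ z, ∑ j, e (some j) (a - z) q.2 * y j z q.1
  have hΨ : Measurable Ψ := by
    refine measurable_pi_lambda _ fun a ↦ Measurable.add ?_ ?_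
    · exact (measurable_pi_apply (a : Inp D)).comp ((measurable_pi_apply none).comp measurable_snd)
    · have hm : StronglyMeasurable
          (Function.uncurry fun (q : S × (Option J → Inp D → ℝ)) (z : Inp D) ↦
            ∑ j, e (some j) (a - z) q.2 * y j z q.1) := by
        refine (Finset.measurable_fun_sum _ fun j _ ↦ ?_).stronglyMeasurable
        exact ((he (some j)).comp (by fun_prop : Measurable
          fun q : (S × (Option J → Inp D → ℝ)) × Inp D ↦ ((a : Inp D) - q.2, q.1.2))).mul
          ((hy j).comp (by fun_prop : Measurable
          fun q : (S × (Option J → Inp D → ℝ)) × Inp D ↦ (q.2, q.1.1)))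
      exact hm.integral_prod_right.measurable
  have hfΨ : (fun ω ↦ I.restrict fun x ↦ f x ω) =ᵐ[P]
      fun ω ↦ Ψ (H ω, fun s x ↦ V s x ω) := by
    filter_upwards [ae_all_iff.2 fun a : I ↦ hf a, ae_all_iff.2 fun a : I ↦ hVe a] with ω h1 h2
    ext a
    refine (h1 a).trans ?_
    congr 1
    refine integral_congr_ae ?_
    filter_upwards [h2 a] with z hz
    simp only [hz]
  rw [condDistrib_congr_left hfΨ]
  filter_upwards [condDistrib_ae_eq_map_of_indepFun hH hpath hHV hΨ,
    ae_all_iff.2 fun a : I ↦ ae_lintegral_eLpNorm_lt_top hV hVm hind hH hHV hy a (hint a)]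
    with s hs hN t
  -- With the Dirac mass at 0 and weight 1, the process `V none` becomes a convolution of itself, so
  -- one formula covers it and the genuine integrals.
  let μ : Option J → Measure (Inp D) := fun r ↦ r.elim (.dirac 0) fun _ ↦ volume
  let Y : Option J → Inp D → ℝ := fun r z ↦ r.elim 1 fun j ↦ y j z s
  have hμ : ∀ r, SFinite (μ r) := by rintro (_ | j) <;> simp only [μ, Option.elim] <;> infer_instance
  have hY : ∀ r, Measurable (Y r) := by
    rintro (_ | j)
    · exact measurable_const
    · exact (hy j).comp measurable_prodMk_right
  have hm := fun r (a : I) ↦ measurable_convolution_integrand hVm hY r (a : Inp D)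
  have hNY : ∀ r (a : I), ∫⁻ z, eLpNorm (fun ω ↦ V r (a - z) ω * Y r z) 2 P ∂(μ r) < ∞ := by
    rintro (_ | j) a
    · simp only [μ, Option.elim]
      rw [lintegral_dirac' _ (measurable_eLpNorm_two (hm none a))]
      exact (memLp_two_convolution_integrand hV none (a : Inp D) 0).2
    · exact hN a j
  have key := integral_exp_sum_convolution_eq hV hVm hind hY (μ := μ) (fun a : I ↦ (a : Inp D)) hNY t
  have hsum : ∀ a b : I, ∑ r, ∫ p : Inp D × Inp D, K r (a - p.1) (b - p.2) * Y r p.1 * Y r p.2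
        ∂((μ r).prod (μ r))
      = K none a b + ∑ j, ∫ p : Inp D × Inp D,
          K (some j) (a - p.1) (b - p.2) * y j p.1 s * y j p.2 s ∂(volume.prod volume) := by
    intro a b
    rw [Fintype.sum_option]
    congr 1
    simp [μ, Y, Measure.dirac_prod_dirac]
  simp only [hsum] at key
  have hΨs : Measurable fun ω ↦ Ψ (s, fun s x ↦ V s x ω) :=
    hΨ.comp (measurable_prodMk_left.comp hpath)
  rw [hs, integral_map hΨs.aemeasurable (Continuous.aestronglyMeasurable (by fun_prop)), ← key]
  refine integral_congr_ae ?_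
  filter_upwards [ae_all_iff.2 fun a : I ↦ hVe a, ae_all_iff.2 fun a : I ↦ ae_all_iff.2 fun j ↦
    ae_integrable_of_lintegral_eLpNorm_lt_top (hm (some j) a) (hNY (some j) a)] with ω h1 h2
  have h3 : ∀ a, Ψ (s, fun s x ↦ V s x ω) a = ∑ r, ∫ z, V r (a - z) ω * Y r z ∂(μ r) := by
    intro a
    have hd : ∫ z, V none (a - z) ω * Y none z ∂(μ none) = V none a ω := by
      simp [μ, Y]
    rw [Fintype.sum_option, hd]
    change V none a ω + _ = _
    congr 1
    refine Eq.trans (integral_congr_ae ?_)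
      (integral_finsetSum Finset.univ (μ := volume) fun j _ ↦ h2 a j)
    filter_upwards [h1 a] with z hz
    simp only [hz]
    rfl
  simp only [h3]

end Conditional

/-! ### Centred Gaussian laws on ℝ^ι via characteristic functions. -/

section CharFun

variable {ι : Type*} [Fintype ι]

/-- The characteristic function of a measure on `ℝ^ι`. -/
def charPi (ν : Measure (ι → ℝ)) (t : ι → ℝ) : ℂ :=
  ∫ w, Complex.exp ((∑ a, t a * w a : ℝ) * Complex.I) ∂ν

/-- The quadratic form of a matrix. -/
def quadPi (C : ι → ι → ℝ) (t : ι → ℝ) : ℝ := ∑ a, ∑ b, t a * t b * C a b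

lemma measurable_sum_mul (t : ι → ℝ) : Measurable fun w : ι → ℝ ↦ ∑ a, t a * w a :=
  Finset.measurable_fun_sum _ fun a _ ↦ (measurable_pi_apply a).const_mul _

lemma dual_apply_eq_sum [DecidableEq ι] (L : StrongDual ℝ (ι → ℝ)) (w : ι → ℝ) :
    L w = ∑ a, L (Pi.single a 1) * w a := by
  have h : w = ∑ a, w a • (Pi.single a 1 : ι → ℝ) := by
    ext b
    simp [Finset.sum_apply, Pi.single_apply]
  conv_lhs => rw [h]
  simp only [map_sum, map_smul, smul_eq_mul, mul_comm]

lemma charFunDual_eq_charPi [DecidableEq ι] (ν : Measure (ι → ℝ)) (L : StrongDual ℝ (ι → ℝ)) :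
    charFunDual ν L = charPi ν fun a ↦ L (Pi.single a 1) := by
  rw [charFunDual_apply, charPi]
  congr 1
  ext w
  rw [dual_apply_eq_sum L w]

lemma ext_of_charPi {ν ν' : Measure (ι → ℝ)} [IsFiniteMeasure ν] [IsFiniteMeasure ν']
    (h : ∀ t, charPi ν t = charPi ν' t) : ν = ν' := by
  classical
  refine Measure.ext_of_charFunDual ?_
  ext L
  rw [charFunDual_eq_charPi, charFunDual_eq_charPi, h]

lemma continuous_charPi (ν : Measure (ι → ℝ)) [IsFiniteMeasure ν] : Continuous (charPi ν) := by
  refine continuous_of_dominated (bound := fun _ ↦ 1) (fun t ↦ ?_) (fun t ↦ ?_)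
    (integrable_const _) (Filter.Eventually.of_forall fun w ↦ by fun_prop)
  · exact Continuous.aestronglyMeasurable (by fun_prop)
  · exact Filter.Eventually.of_forall fun w ↦ by rw [Complex.norm_exp_ofReal_mul_I]

lemma charFun_map_sum_eq_charPi (ν : Measure (ι → ℝ)) (t : ι → ℝ) (r : ℝ) :
    charFun (ν.map fun w ↦ ∑ a, t a * w a) r = charPi ν (r • t) := by
  rw [charFun_apply_real, integral_map (measurable_sum_mul t).aemeasurable (by fun_prop), charPi]
  congr 1
  ext w
  simp [Finset.mul_sum, mul_assoc]

lemma norm_charPi_le_one (ν : Measure (ι → ℝ)) [IsProbabilityMeasure ν] (t : ι → ℝ) :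
    ‖charPi ν t‖ ≤ 1 := by
  refine (norm_integral_le_of_norm_le_const (C := 1)
    (Filter.Eventually.of_forall fun w ↦ by rw [Complex.norm_exp_ofReal_mul_I])).trans ?_
  simp

lemma quadPi_smul (C : ι → ι → ℝ) (t : ι → ℝ) (r : ℝ) :
    quadPi C (r • t) = r ^ 2 * quadPi C t := by
  simp only [quadPi, Finset.mul_sum]
  refine Finset.sum_congr rfl fun a _ ↦ Finset.sum_congr rfl fun b _ ↦ ?_
  simp
  ring

lemma quadPi_single [DecidableEq ι] (C : ι → ι → ℝ) (a : ι) : quadPi C (Pi.single a 1) = C a a := by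
  simp [quadPi, Pi.single_apply]

lemma quadPi_single_add_single [DecidableEq ι] {C : ι → ι → ℝ} (hC : ∀ a b, C a b = C b a)
    (a b : ι) :
    quadPi C (Pi.single a 1 + Pi.single b 1) = C a a + C b b + 2 * C a b := by
  simp [quadPi, Pi.single_apply, add_mul, mul_add, Finset.sum_add_distrib, hC b a]
  ring

lemma sum_single_mul [DecidableEq ι] (a : ι) (w : ι → ℝ) :
    ∑ b, (Pi.single a 1 : ι → ℝ) b * w b = w a := by
  simp [Pi.single_apply]

/-- This turns the conditional Gaussian statement into an identity between functions of the
conditioning value that are visibly measurable. Symmetry of C is needed because the quadratic form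
sees only the symmetric part. -/
lemma isCenteredGaussian_iff_charPi {ν : Measure (ι → ℝ)} [IsProbabilityMeasure ν]
    {C : ι → ι → ℝ} (hC : ∀ a b, C a b = C b a) :
    IsCenteredGaussian ν C ↔ ∀ t, charPi ν t = Complex.exp (-(quadPi C t / 2 : ℝ)) := by
  classical
  refine ⟨fun h t ↦ ?_, fun h ↦ ?_⟩
  · have := h.isGaussian
    have h2 : ∀ a, MemLp (fun w : ι → ℝ ↦ w a) 2 ν := fun a ↦
      IsGaussian.memLp_dual ν (ContinuousLinearMap.proj a) 2 (by simp)
    let L : StrongDual ℝ (ι → ℝ) := ∑ a, t a • ContinuousLinearMap.proj a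
    have hL : ∀ w, L w = ∑ a, t a * w a := fun w ↦ by simp [L]
    have hLt : (fun a ↦ L (Pi.single a 1)) = t := by
      ext a
      simp [hL, Pi.single_apply]
    have hmean : ∫ w, L w ∂ν = 0 := by
      simp only [hL]
      rw [integral_finsetSum _ fun a _ ↦ ((h2 a).integrable (by norm_num)).const_mul _]
      simp [integral_const_mul, h.mean_eq_zero]
    have hvar : Var[L; ν] = quadPi C t := by
      have h1 : (L : (ι → ℝ) → ℝ) = fun w ↦ ∑ a, t a * w a := funext hL
      rw [h1, ← covariance_self (measurable_sum_mul t).aemeasurable, covariance_fun_sum_fun_sum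
        (fun a ↦ (h2 a).const_mul _) fun a ↦ (h2 a).const_mul _, quadPi]
      refine Finset.sum_congr rfl fun a _ ↦ Finset.sum_congr rfl fun b _ ↦ ?_
      rw [covariance_const_mul_left, covariance_const_mul_right, h.cov_eq, mul_assoc]
    have := IsGaussian.charFunDual_eq (μ := ν) L
    rw [charFunDual_eq_charPi, hLt, integral_complex_ofReal, hmean, hvar] at this
    rw [this]
    simp
  -- Positive semidefiniteness is not assumed; it follows because a characteristic function has
  -- modulus at most 1.
  · have hq : ∀ t, 0 ≤ quadPi C t := by
      intro t
      have h1 := norm_charPi_le_one ν t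
      rw [h t, ← Complex.ofReal_neg, Complex.norm_exp_ofReal, Real.exp_le_one_iff] at h1
      linarith
    have hmap : ∀ t : ι → ℝ, ν.map (fun w ↦ ∑ a, t a * w a)
        = gaussianReal 0 (quadPi C t).toNNReal := by
      intro t
      have := Measure.isProbabilityMeasure_map (μ := ν)
        (measurable_sum_mul t).aemeasurable
      refine Measure.ext_of_charFun ?_
      ext r
      rw [charFun_map_sum_eq_charPi, h, charFun_gaussianReal, quadPi_smul,
        Real.coe_toNNReal _ (hq t)]
      congr 1
      push_cast
      ring
    have hmap_single : ∀ a, ν.map (fun w ↦ w a) = gaussianReal 0 (C a a).toNNReal := by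
      intro a
      have := hmap (Pi.single a 1)
      simpa only [sum_single_mul, quadPi_single] using this
    have h2 : ∀ a, MemLp (fun w : ι → ℝ ↦ w a) 2 ν := fun a ↦ by
      have := memLp_id_gaussianReal (μ := 0) (v := (C a a).toNNReal) 2
      rw [← hmap_single] at this
      exact (memLp_map_measure_iff (g := id) aestronglyMeasurable_id
        (measurable_pi_apply a).aemeasurable).1 this
    have hvar : ∀ t : ι → ℝ, Var[fun w ↦ ∑ a, t a * w a; ν] = quadPi C t := by
      intro t
      have h1 := variance_id_gaussianReal (μ := 0) (v := (quadPi C t).toNNReal)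
      rw [← hmap t, variance_map (by fun_prop) (measurable_sum_mul t).aemeasurable, Real.coe_toNNReal _ (hq t)] at h1
      exact h1
    have hvar_single : ∀ a, Var[fun w ↦ w a; ν] = C a a := by
      intro a
      have := hvar (Pi.single a 1)
      simpa only [sum_single_mul, quadPi_single] using this
    refine ⟨isGaussian_of_map_eq_gaussianReal fun L ↦ ⟨0,
      (quadPi C fun a ↦ L (Pi.single a 1)).toNNReal, ?_⟩, fun a ↦ ?_, fun a b ↦ ?_⟩
    · rw [← hmap]
      congr 1
      ext w
      exact dual_apply_eq_sum L w
    · have h1 := integral_id_gaussianReal (μ := 0) (v := (C a a).toNNReal)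
      rw [← hmap_single, integral_map (measurable_pi_apply a).aemeasurable (by fun_prop)] at h1
      exact h1
    -- Off-diagonal covariances are recovered by polarization.
    · have h1 := hvar (Pi.single a 1 + Pi.single b 1)
      simp only [Pi.add_apply, add_mul, Finset.sum_add_distrib, sum_single_mul] at h1
      rw [quadPi_single_add_single hC, variance_fun_add (h2 a) (h2 b), hvar_single,
        hvar_single] at h1
      linarith

end CharFun

/-! ### Measurable versions of the past, and condition (2) in terms of laws. -/

section Version

variable {D M : ℕ} {i : Fin M}

/-- `e` is a jointly measurable version of the evaluation map under the law `ν`. -/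
structure IsMeasurableVersion (ν : Measure (Inp D → Set.Iio i → ℝ))
    (e : Inp D → (Inp D → Set.Iio i → ℝ) → Set.Iio i → ℝ) : Prop where
  measurable : ∀ j, Measurable fun p : Inp D × (Inp D → Set.Iio i → ℝ) ↦ e p.1 p.2 j
  ae_eq : ∀ x j, ∀ᵐ y ∂ν, y x j = e x y j

variable {Ω : Type*} [MeasurableSpace Ω] {P : Measure Ω} [IsProbabilityMeasure P]
  {g : Inp D → Ω → Fin M → ℝ}

lemma measurable_past (hg : ∀ i, Measurable fun p : Inp D × Ω ↦ g p.1 p.2 i) (i : Fin M) :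
    Measurable fun ω ↦ past i fun x ↦ g x ω :=
  measurable_pi_lambda _ fun _ ↦ measurable_pi_lambda _ fun j ↦
    (hg j).comp measurable_prodMk_left

lemma exists_isMeasurableVersion (hg : ∀ i, Measurable fun p : Inp D × Ω ↦ g p.1 p.2 i)
    (i : Fin M) : ∃ e, IsMeasurableVersion (P.map fun ω ↦ past i fun x ↦ g x ω) e := by
  choose e he hge using fun j : Set.Iio i ↦ exists_measurable_factor P (hg j)
    (H := fun ω ↦ past i fun x ↦ g x ω) fun x ↦ ⟨fun y ↦ y x j,
      (measurable_pi_apply j).comp (measurable_pi_apply x), Filter.EventuallyEq.rfl⟩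
  refine ⟨fun x y j ↦ e j x y, he, fun x j ↦ ?_⟩
  rw [ae_map_iff (measurable_past hg i).aemeasurable]
  · exact hge j x
  · exact measurableSet_eq_fun ((measurable_pi_apply j).comp (measurable_pi_apply x))
      ((he j).comp measurable_prodMk_left)

lemma IsMeasurableVersion.ae_ae_eq (hg : ∀ i, Measurable fun p : Inp D × Ω ↦ g p.1 p.2 i)
    {e : Inp D → (Inp D → Set.Iio i → ℝ) → Set.Iio i → ℝ}
    (he : IsMeasurableVersion (P.map fun ω ↦ past i fun x ↦ g x ω) e) :
    ∀ᵐ ω ∂P, ∀ᵐ z ∂(volume : Measure (Inp D)), ∀ j : Set.Iio i,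
      g z ω j = e z (past i fun x ↦ g x ω) j := by
  have h : ∀ j : Set.Iio i, ∀ᵐ ω ∂P, ∀ᵐ z ∂(volume : Measure (Inp D)),
      g z ω j = e z (past i fun x ↦ g x ω) j := fun j ↦
    ae_ae_eq_of_forall_ae_eq (Y := fun z ω ↦ g z ω j)
      (Z := fun z ω ↦ e z (past i fun x ↦ g x ω) j) (hg j)
      ((he.measurable j).comp
        (measurable_fst.prodMk ((measurable_past hg i).comp measurable_snd)))
      fun z ↦ ae_of_ae_map (measurable_past hg i).aemeasurable (he.ae_eq z j)
  filter_upwards [ae_all_iff.2 h] with ω hω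
  exact ae_all_iff.2 hω

variable {kA : Fin M → Fin M → Inp D → Inp D → ℝ}

lemma kernelIntegrand_ae_eq {y y' : Inp D → Set.Iio i → ℝ}
    (h : ∀ᵐ z ∂(volume : Measure (Inp D)), ∀ j, y z j = y' z j) (j : Set.Iio i) (x x' : Inp D) :
    kernelIntegrand kA i j x y x' y =ᵐ[volume.prod volume] kernelIntegrand kA i j x y' x' y' := by
  filter_upwards [Measure.quasiMeasurePreserving_fst.ae h,
    Measure.quasiMeasurePreserving_snd.ae h] with p h1 h2
  simp only [kernelIntegrand, h1, h2]

lemma kernelA_congr {y y' : Inp D → Set.Iio i → ℝ}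
    (h : ∀ᵐ z ∂(volume : Measure (Inp D)), ∀ j, y z j = y' z j) (x x' : Inp D) :
    kernelA kA i x y x' y = kernelA kA i x y' x' y' :=
  Finset.sum_congr rfl fun j _ ↦ integral_congr_ae (kernelIntegrand_ae_eq h j x x')

lemma kernelA_comm (hk : ∀ j < i, ∀ x x', kA i j x x' = kA i j x' x)
    (y : Inp D → Set.Iio i → ℝ) (x x' : Inp D) :
    kernelA kA i x y x' y = kernelA kA i x' y x y := by
  refine Finset.sum_congr rfl fun j _ ↦ ?_
  rw [← integral_prod_swap]
  refine integral_congr_ae (Filter.Eventually.of_forall fun p ↦ ?_)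
  simp only [kernelIntegrand, Prod.fst_swap, Prod.snd_swap, hk j j.2 (x - p.2) (x' - p.1)]
  ring

variable {e : Inp D → (Inp D → Set.Iio i → ℝ) → Set.Iio i → ℝ}

lemma measurable_kernelIntegrand (hk : ∀ j < i, Measurable fun p : Inp D × Inp D ↦ kA i j p.1 p.2)
    (he : ∀ j, Measurable fun p : Inp D × (Inp D → Set.Iio i → ℝ) ↦ e p.1 p.2 j) (j : Set.Iio i)
    (x x' : Inp D) :
    Measurable (Function.uncurry fun (s : Inp D → Set.Iio i → ℝ) ↦
      kernelIntegrand kA i j x (fun z ↦ e z s) x' (fun z ↦ e z s)) := by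
  refine Measurable.mul (Measurable.mul ?_ ?_) ?_
  · exact (hk j j.2).comp (by fun_prop : Measurable
      fun q : (Inp D → Set.Iio i → ℝ) × Inp D × Inp D ↦ (x - q.2.1, x' - q.2.2))
  · exact (he j).comp (by fun_prop : Measurable
      fun q : (Inp D → Set.Iio i → ℝ) × Inp D × Inp D ↦ (q.2.1, q.1))
  · exact (he j).comp (by fun_prop : Measurable
      fun q : (Inp D → Set.Iio i → ℝ) × Inp D × Inp D ↦ (q.2.2, q.1))

lemma measurable_kernelA (hk : ∀ j < i, Measurable fun p : Inp D × Inp D ↦ kA i j p.1 p.2)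
    (he : ∀ j, Measurable fun p : Inp D × (Inp D → Set.Iio i → ℝ) ↦ e p.1 p.2 j) (x x' : Inp D) :
    Measurable fun s ↦ kernelA kA i x (fun z ↦ e z s) x' (fun z ↦ e z s) :=
  Finset.measurable_fun_sum _ fun j _ ↦
    (measurable_kernelIntegrand hk he j x x').stronglyMeasurable.integral_prod_right.measurable

lemma measurable_charPi_kernel {S ι : Type*} [MeasurableSpace S] [Fintype ι]
    (κ : Kernel S (ι → ℝ)) [IsMarkovKernel κ] (t : ι → ℝ) :
    Measurable fun s ↦ charPi (κ s) t := by
  have h : StronglyMeasurable fun w : ι → ℝ ↦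
      Complex.exp ((∑ a, t a * w a : ℝ) * Complex.I) :=
    Continuous.stronglyMeasurable (by fun_prop)
  exact h.integral_kernel.measurable

/-- Continuity in t reduces the uncountable intersection to a countable dense set. -/
lemma measurableSet_forall_eq {S E : Type*} [MeasurableSpace S] [TopologicalSpace E]
    [TopologicalSpace.SeparableSpace E] [Nonempty E] {F G : S → E → ℂ}
    (hF : ∀ t, Measurable fun s ↦ F s t) (hG : ∀ t, Measurable fun s ↦ G s t)
    (hFc : ∀ s, Continuous (F s)) (hGc : ∀ s, Continuous (G s)) :
    MeasurableSet {s | ∀ t, F s t = G s t} := by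
  have h : {s | ∀ t, F s t = G s t}
      = ⋂ n, {s | F s (TopologicalSpace.denseSeq E n) = G s (TopologicalSpace.denseSeq E n)} := by
    ext s
    simp only [Set.mem_ofPred_eq, Set.mem_iInter]
    refine ⟨fun h n ↦ h _, fun h t ↦ congrFun ((hFc s).ext_on
      (TopologicalSpace.denseRange_denseSeq E) (hGc s) ?_) t⟩
    rintro _ ⟨n, rfl⟩
    exact h n
  rw [h]
  exact MeasurableSet.iInter fun n ↦ measurableSet_eq_fun (hF _) (hG _)

/-- The conditional distribution condition on the `i`-th component, expressed through the law of
the past, the conditional distributions, and a measurable version of the evaluation map. -/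
theorem condition_iff_charPi {k : Inp D → Inp D → ℝ}
    (hksymm : ∀ x x', k x x' = k x' x)
    (hkA : ∀ j < i, Measurable fun p : Inp D × Inp D ↦ kA i j p.1 p.2)
    (hkAsymm : ∀ j < i, ∀ x x', kA i j x x' = kA i j x' x)
    (hg : ∀ i, Measurable fun p : Inp D × Ω ↦ g p.1 p.2 i)
    (he : IsMeasurableVersion (P.map fun ω ↦ past i fun x ↦ g x ω) e) :
    ((∀ x x', ∀ᵐ ω ∂P, ∀ j : Set.Iio i, Integrable (kernelIntegrand kA i j
          x (past i fun z ↦ g z ω) x' (past i fun z ↦ g z ω)) (volume.prod volume)) ∧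
      IsCondCenteredGP (fun x ω ↦ g x ω i) (fun ω ↦ past i fun x ↦ g x ω)
        (fun y x x' ↦ k x x' + kernelA kA i x y x' y) P) ↔
    ((∀ x x', ∀ᵐ s ∂(P.map fun ω ↦ past i fun x ↦ g x ω), ∀ j : Set.Iio i,
        Integrable (kernelIntegrand kA i j x (fun z ↦ e z s) x' (fun z ↦ e z s))
          (volume.prod volume)) ∧
      ∀ I : Finset (Inp D), ∀ᵐ s ∂(P.map fun ω ↦ past i fun x ↦ g x ω), ∀ t,
        charPi (condDistrib (fun ω ↦ I.restrict fun x ↦ g x ω i)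
          (fun ω ↦ past i fun x ↦ g x ω) P s) t
        = Complex.exp (-(quadPi (fun a b : I ↦ k a b
            + kernelA kA i a (fun z ↦ e z s) b (fun z ↦ e z s)) t / 2 : ℝ))) := by
  have hH := (measurable_past hg i).aemeasurable (μ := P)
  have hge := he.ae_ae_eq hg
  -- Moving an almost sure statement from P to the law of the past requires a measurable event. With
  -- e in place of evaluation, both events are measurable.
  refine and_congr (forall_congr' fun x ↦ forall_congr' fun x' ↦ ?_) (forall_congr' fun I ↦ ?_)
  · rw [ae_map_iff hH]
    · refine Filter.eventually_congr ?_
      filter_upwards [hge] with ω hω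
      exact forall_congr' fun j ↦ integrable_congr (kernelIntegrand_ae_eq hω j x x')
    · simp only [Set.ofPred_forall]
      exact MeasurableSet.iInter fun j ↦ _root_.measurableSet_integrable
        (measurable_kernelIntegrand hkA he.measurable j x x').stronglyMeasurable
  · rw [ae_map_iff hH]
    · refine Filter.eventually_congr ?_
      filter_upwards [hge] with ω hω
      rw [isCenteredGaussian_iff_charPi]
      · refine forall_congr' fun t ↦ ?_
        have : ∀ a b : I, kernelA kA i a (past i fun z ↦ g z ω) b (past i fun z ↦ g z ω)
            = kernelA kA i a (fun z ↦ e z (past i fun x ↦ g x ω)) b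
              (fun z ↦ e z (past i fun x ↦ g x ω)) := fun a b ↦ kernelA_congr hω _ _
        simp only [this]
      · intro a b
        rw [hksymm, kernelA_comm hkAsymm]
    · refine measurableSet_forall_eq (fun t ↦ measurable_charPi_kernel _ t) (fun t ↦ ?_)
        (fun s ↦ continuous_charPi _) fun s ↦ ?_
      · refine Complex.measurable_exp.comp (Complex.measurable_ofReal.comp
          (Measurable.div_const ?_ _)).neg
        exact Finset.measurable_fun_sum _ fun a _ ↦ Finset.measurable_fun_sum _ fun b _ ↦
          ((measurable_kernelA hkA he.measurable _ _).const_add _).const_mul _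
      · simp only [quadPi]
        fun_prop

end Version

/-! ### Condition (2) depends only on the law, determines it, and holds for the response. -/

section Equivalence

variable {D M : ℕ}

/-- The conditional distribution condition on the `i`-th component of the process `g`. -/
def RowCondition (k : Inp D → Inp D → ℝ) (kA : Fin M → Fin M → Inp D → Inp D → ℝ) (i : Fin M)
    {Ω : Type*} [MeasurableSpace Ω] (P : Measure Ω) [IsProbabilityMeasure P]
    (g : Inp D → Ω → Fin M → ℝ) : Prop :=
  (∀ x x', ∀ᵐ ω ∂P, ∀ j : Set.Iio i, Integrable (kernelIntegrand kA i j
      x (past i fun z ↦ g z ω) x' (past i fun z ↦ g z ω)) (volume.prod volume)) ∧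
    IsCondCenteredGP (fun x ω ↦ g x ω i) (fun ω ↦ past i fun x ↦ g x ω)
      (fun y x x' ↦ k x x' + kernelA kA i x y x' y) P

variable {Ω Ω' : Type*} [MeasurableSpace Ω] [MeasurableSpace Ω'] {P : Measure Ω}
  {P' : Measure Ω'}

lemma IsCenteredGP.kernel_comm {T : Type*} {X : T → Ω → ℝ} {k : T → T → ℝ}
    (h : IsCenteredGP X k P) (s t : T) : k s t = k t s := by
  rw [← h.cov_eq, ← h.cov_eq, covariance_comm]

lemma IsCenteredGP.measurable_kernel {T : Type*} [MeasurableSpace T] [SFinite P] {X : T → Ω → ℝ}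
    {k : T → T → ℝ} (h : IsCenteredGP X k P) (hX : Measurable fun p : T × Ω ↦ X p.1 p.2) :
    Measurable fun p : T × T ↦ k p.1 p.2 := by
  simp only [← h.integral_mul_eq]
  have hm : StronglyMeasurable (Function.uncurry fun (p : T × T) ω ↦ X p.1 ω * X p.2 ω) :=
    ((hX.comp (by fun_prop : Measurable fun q : (T × T) × Ω ↦ (q.1.1, q.2))).mul
      (hX.comp (by fun_prop : Measurable fun q : (T × T) × Ω ↦ (q.1.2, q.2)))).stronglyMeasurable
  exact hm.integral_prod_right.measurable

lemma map_comp_eq {E F : Type*} [MeasurableSpace E] [MeasurableSpace F] {X : Ω → E} {X' : Ω' → E}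
    (h : P'.map X' = P.map X) (hX : Measurable X) (hX' : Measurable X') {f : E → F}
    (hf : Measurable f) : (P'.map fun ω ↦ f (X' ω)) = P.map fun ω ↦ f (X ω) := by
  have h1 := congrArg (Measure.map f) h
  rwa [Measure.map_map hf hX', Measure.map_map hf hX] at h1

lemma condDistrib_eq_of_map_eq {S E : Type*} [MeasurableSpace S] [MeasurableSpace E]
    [StandardBorelSpace E] [Nonempty E] [IsFiniteMeasure P] [IsFiniteMeasure P'] {X : Ω → S}
    {Y : Ω → E} {X' : Ω' → S} {Y' : Ω' → E}
    (h : (P'.map fun ω ↦ (X' ω, Y' ω)) = P.map fun ω ↦ (X ω, Y ω)) :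
    condDistrib Y' X' P' = condDistrib Y X P := by
  simp only [condDistrib, h]

variable [IsProbabilityMeasure P] [IsProbabilityMeasure P']
  {g : Inp D → Ω → Fin M → ℝ} {g' : Inp D → Ω' → Fin M → ℝ} {i : Fin M}
  {k : Inp D → Inp D → ℝ} {kA : Fin M → Fin M → Inp D → Inp D → ℝ}

lemma measurable_path (hg : ∀ i, Measurable fun p : Inp D × Ω ↦ g p.1 p.2 i) :
    Measurable fun ω x ↦ g x ω :=
  measurable_pi_lambda _ fun _ ↦ measurable_pi_lambda _ fun j ↦ (hg j).comp measurable_prodMk_left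

lemma measurable_eval (x : Inp D) (i : Fin M) : Measurable fun f : Inp D → Fin M → ℝ ↦ f x i :=
  (measurable_pi_apply i).comp (measurable_pi_apply x)

lemma measurable_past_fun (i : Fin M) : Measurable (past (D := D) i) :=
  measurable_pi_lambda _ fun x ↦ measurable_pi_lambda _ fun j ↦ measurable_eval x (j : Fin M)

/-- The condition on the `i`-th component depends only on the law of the process. -/
lemma RowCondition.of_map_eq (hksymm : ∀ x x', k x x' = k x' x)
    (hkA : ∀ j < i, Measurable fun p : Inp D × Inp D ↦ kA i j p.1 p.2)
    (hkAsymm : ∀ j < i, ∀ x x', kA i j x x' = kA i j x' x)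
    (hg : ∀ i, Measurable fun p : Inp D × Ω ↦ g p.1 p.2 i)
    (hg' : ∀ i, Measurable fun p : Inp D × Ω' ↦ g' p.1 p.2 i)
    (hlaw : (P'.map fun ω x ↦ g' x ω) = P.map fun ω x ↦ g x ω)
    (h : RowCondition k kA i P g) : RowCondition k kA i P' g' := by
  obtain ⟨e, he⟩ := exists_isMeasurableVersion (P := P) hg i
  have hpast : (P'.map fun ω ↦ past i fun x ↦ g' x ω) = P.map fun ω ↦ past i fun x ↦ g x ω :=
    map_comp_eq hlaw (measurable_path hg) (measurable_path hg') (measurable_past_fun i)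
  have hcond : ∀ I : Finset (Inp D),
      condDistrib (fun ω ↦ I.restrict fun x ↦ g' x ω i) (fun ω ↦ past i fun x ↦ g' x ω) P'
        = condDistrib (fun ω ↦ I.restrict fun x ↦ g x ω i) (fun ω ↦ past i fun x ↦ g x ω) P :=
    fun I ↦ condDistrib_eq_of_map_eq <| map_comp_eq hlaw (measurable_path hg) (measurable_path hg')
      (f := fun f ↦ (past i f, I.restrict fun x ↦ f x i)) ((measurable_past_fun i).prodMk
        (measurable_pi_lambda _ fun a ↦ measurable_eval (a : Inp D) i))
  have he' : IsMeasurableVersion (P'.map fun ω ↦ past i fun x ↦ g' x ω) e := by rwa [hpast]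
  rw [RowCondition, condition_iff_charPi hksymm hkA hkAsymm hg' he']
  rw [RowCondition, condition_iff_charPi hksymm hkA hkAsymm hg he] at h
  simpa only [hpast, hcond] using h

/-- The law of the past and the condition on the `i`-th component determine the joint law of the
past and of the `i`-th component. -/
lemma RowCondition.map_prodMk_eq (hksymm : ∀ x x', k x x' = k x' x)
    (hkA : ∀ j < i, Measurable fun p : Inp D × Inp D ↦ kA i j p.1 p.2)
    (hkAsymm : ∀ j < i, ∀ x x', kA i j x x' = kA i j x' x)
    (hg : ∀ i, Measurable fun p : Inp D × Ω ↦ g p.1 p.2 i)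
    (hg' : ∀ i, Measurable fun p : Inp D × Ω' ↦ g' p.1 p.2 i)
    (hpast : (P'.map fun ω ↦ past i fun x ↦ g' x ω) = P.map fun ω ↦ past i fun x ↦ g x ω)
    (h : RowCondition k kA i P g) (h' : RowCondition k kA i P' g') (I : Finset (Inp D)) :
    (P'.map fun ω ↦ (past i fun x ↦ g' x ω, I.restrict fun x ↦ g' x ω i))
      = P.map fun ω ↦ (past i fun x ↦ g x ω, I.restrict fun x ↦ g x ω i) := by
  obtain ⟨e, he⟩ := exists_isMeasurableVersion (P := P) hg i
  have he' : IsMeasurableVersion (P'.map fun ω ↦ past i fun x ↦ g' x ω) e := by rwa [hpast]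
  rw [RowCondition, condition_iff_charPi hksymm hkA hkAsymm hg' he', hpast] at h'
  rw [RowCondition, condition_iff_charPi hksymm hkA hkAsymm hg he] at h
  have hI : Measurable fun ω ↦ I.restrict fun x ↦ g x ω i :=
    measurable_pi_lambda _ fun a ↦ (hg i).comp measurable_prodMk_left
  have hI' : Measurable fun ω ↦ I.restrict fun x ↦ g' x ω i :=
    measurable_pi_lambda _ fun a ↦ (hg' i).comp measurable_prodMk_left
  -- Disintegrate both joint laws over the common law of the past; the conditional laws share their
  -- characteristic function for almost every past.
  rw [← compProd_map_condDistrib hI.aemeasurable, ← compProd_map_condDistrib hI'.aemeasurable,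
    hpast]
  refine Measure.compProd_congr ?_
  filter_upwards [h.2 I, h'.2 I] with s h1 h2
  exact ext_of_charPi fun t ↦ (h2 t).trans (h1 t).symm

omit [IsProbabilityMeasure P'] in
lemma map_eq_of_forall_restrict {T E : Type*} [MeasurableSpace E] {X : T → Ω → E}
    {X' : T → Ω' → E} (hX : Measurable fun ω t ↦ X t ω) (hX' : Measurable fun ω t ↦ X' t ω)
    (h : ∀ I : Finset T, (P'.map fun ω ↦ I.restrict (X' · ω)) = P.map fun ω ↦ I.restrict (X · ω)) :
    (P'.map fun ω t ↦ X' t ω) = P.map fun ω t ↦ X t ω := by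
  have h1 := isProjectiveLimit_map hX'.aemeasurable (P := P')
  simp_rw [h] at h1
  exact h1.unique (isProjectiveLimit_map hX.aemeasurable)

/-- Two processes that satisfy the conditions on all components have the same law. -/
theorem map_eq_of_rowCondition {ku : Fin M → Inp D → Inp D → ℝ}
    (hksymm : ∀ i x x', ku i x x' = ku i x' x)
    (hkA : ∀ i, ∀ j < i, Measurable fun p : Inp D × Inp D ↦ kA i j p.1 p.2)
    (hkAsymm : ∀ i, ∀ j < i, ∀ x x', kA i j x x' = kA i j x' x)
    (hg : ∀ i, Measurable fun p : Inp D × Ω ↦ g p.1 p.2 i)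
    (hg' : ∀ i, Measurable fun p : Inp D × Ω' ↦ g' p.1 p.2 i)
    (h : ∀ i, RowCondition (ku i) kA i P g) (h' : ∀ i, RowCondition (ku i) kA i P' g') :
    (P'.map fun ω x ↦ g' x ω) = P.map fun ω x ↦ g x ω := by
  have hm : ∀ n, Measurable fun ω (x : Inp D) (j : {j : Fin M // j.val < n}) ↦ g x ω j := fun n ↦
    measurable_pi_lambda _ fun x ↦ measurable_pi_lambda _ fun j ↦ (hg j).comp measurable_prodMk_left
  have hm' : ∀ n, Measurable fun ω (x : Inp D) (j : {j : Fin M // j.val < n}) ↦ g' x ω j := fun n ↦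
    measurable_pi_lambda _ fun x ↦ measurable_pi_lambda _ fun j ↦
      (hg' j).comp measurable_prodMk_left
  have key : ∀ n ≤ M, (P'.map fun ω (x : Inp D) (j : {j : Fin M // j.val < n}) ↦ g' x ω j)
      = P.map fun ω (x : Inp D) (j : {j : Fin M // j.val < n}) ↦ g x ω j := by
    intro n
    induction n with
    | zero =>
      intro _
      have := Measure.isProbabilityMeasure_map (μ := P) (hm 0).aemeasurable
      have := Measure.isProbabilityMeasure_map (μ := P') (hm' 0).aemeasurable
      -- With no components the path space is a single point, on which all probability measures
      -- agree.
      have hE : IsEmpty {j : Fin M // j.val < 0} := ⟨fun j ↦ Nat.not_lt_zero _ j.2⟩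
      ext s -
      rcases s.eq_empty_or_nonempty with rfl | hs
      · simp
      · simp [Subsingleton.eq_univ_of_nonempty hs]
    | succ n ih =>
      intro hn
      let i : Fin M := ⟨n, hn⟩
      have hpast : (P'.map fun ω ↦ past i fun x ↦ g' x ω) = P.map fun ω ↦ past i fun x ↦ g x ω :=
        map_comp_eq (ih (by omega)) (hm n) (hm' n)
          (f := fun f (x : Inp D) (j : Set.Iio i) ↦ f x ⟨j, j.2⟩)
          (measurable_pi_lambda _ fun x ↦ measurable_pi_lambda _ fun j ↦
            (measurable_pi_apply _).comp (measurable_pi_apply x))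
      have hX : Measurable fun ω x ↦ (past i (fun x ↦ g x ω) x, g x ω i) :=
        measurable_pi_lambda _ fun x ↦ ((measurable_pi_apply x).comp (measurable_past hg i)).prodMk
          ((hg i).comp measurable_prodMk_left)
      have hX' : Measurable fun ω x ↦ (past i (fun x ↦ g' x ω) x, g' x ω i) :=
        measurable_pi_lambda _ fun x ↦ ((measurable_pi_apply x).comp (measurable_past hg' i)).prodMk
          ((hg' i).comp measurable_prodMk_left)
      -- The step supplies the new component only at finitely many points. Pairing it with the past
      -- at the same points gives all finite-dimensional laws, which determine the law on path
      -- space.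
      have hjoint := map_eq_of_forall_restrict (P := P) (P' := P') hX hX' fun I ↦
        map_comp_eq (RowCondition.map_prodMk_eq (hksymm i) (hkA i) (hkAsymm i) hg hg' hpast
            (h i) (h' i) I)
          ((measurable_past hg i).prodMk
            (measurable_pi_lambda _ fun a ↦ (hg i).comp measurable_prodMk_left))
          ((measurable_past hg' i).prodMk
            (measurable_pi_lambda _ fun a ↦ (hg' i).comp measurable_prodMk_left))
          (f := fun q (a : I) ↦ (q.1 a, q.2 a))
          (measurable_pi_lambda _ fun a ↦ ((measurable_pi_apply (a : Inp D)).comp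
            measurable_fst).prodMk ((measurable_pi_apply a).comp measurable_snd))
      let φ : (Inp D → (Set.Iio i → ℝ) × ℝ) → Inp D → {j : Fin M // j.val < n + 1} → ℝ :=
        fun f x j ↦ if hj : j.val < i then (f x).1 ⟨j, hj⟩ else (f x).2
      have hφ : Measurable φ := by
        refine measurable_pi_lambda _ fun x ↦ measurable_pi_lambda _ fun j ↦ ?_
        by_cases hj : j.val < i
        · simp only [φ, hj, dif_pos]
          exact (measurable_pi_apply _).comp (measurable_fst.comp (measurable_pi_apply x))
        · simp only [φ, hj, dif_neg, not_false_eq_true]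
          exact measurable_snd.comp (measurable_pi_apply x)
      have hφg : ∀ f : Inp D → Fin M → ℝ, φ (fun x ↦ (past i f x, f x i)) = fun x j ↦ f x j.1 := by
        intro f
        ext x j
        by_cases hj : j.val < i
        · simp only [φ, hj, dif_pos, past]
        · have : i = j.val := Fin.ext (le_antisymm (not_lt.1 hj) (Nat.lt_succ_iff.1 j.2))
          exact (dif_neg hj).trans (congrArg (f x) this)
      have h1 := map_comp_eq hjoint hX hX' hφ
      simpa only [hφg] using h1
  exact map_comp_eq (key M le_rfl) (hm M) (hm' M) (f := fun f x j ↦ f x ⟨j, j.2⟩)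
    (measurable_pi_lambda _ fun x ↦ measurable_pi_lambda _ fun j ↦
      (measurable_pi_apply _).comp (measurable_pi_apply x))

/-- The process `(∑_{n < M} A^n) ∘ u` satisfies the conditions on all components. -/
theorem rowCondition_response {Ahat : Inp D → Ω → Matrix (Fin M) (Fin M) ℝ}
    {u : Inp D → Ω → Fin M → ℝ} {ku : Fin M → Inp D → Inp D → ℝ}
    (hu : ∀ i, Measurable fun p : Inp D × Ω ↦ u p.1 p.2 i)
    (hA : ∀ i j, Measurable fun p : Inp D × Ω ↦ Ahat p.1 p.2 i j)
    (hu_gp : ∀ i, IsCenteredGP (fun x ω ↦ u x ω i) (ku i) P)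
    (hA_gp : ∀ i j, j < i → IsCenteredGP (fun x ω ↦ Ahat x ω i j) (kA i j) P)
    (hA_zero : ∀ i j, i ≤ j → ∀ x ω, Ahat x ω i j = 0)
    (h_indep : iIndepFun (latent Ahat u) P)
    (h_conv : ∀ x, ∀ᵐ ω ∂P, ∀ n : ℕ, n + 1 < M → Integrable (fun z ↦ Ahat (x - z) ω *ᵥ
        ((PathMap.conv (fun x' ↦ Ahat x' ω)).pow n).act (fun x' ↦ u x' ω) z)) (i : Fin M) :
    RowCondition (ku i) kA i P (response Ahat u) := by
  have hresp : ∀ i, Measurable fun p : Inp D × Ω ↦ response Ahat u p.1 p.2 i := fun i ↦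
    (measurable_pi_apply i).comp (measurable_response hA hu)
  obtain ⟨e, he⟩ := exists_isMeasurableVersion (P := P) hresp i
  let V : Option (Set.Iio i) → Inp D → Ω → ℝ := rowProcess Ahat u i
  let K : Option (Set.Iio i) → Inp D → Inp D → ℝ := fun s ↦ s.elim (ku i) fun j ↦ kA i j
  let H : Ω → Inp D → Set.Iio i → ℝ := fun ω ↦ past i fun x ↦ response Ahat u x ω
  let y : Set.Iio i → Inp D → (Inp D → Set.Iio i → ℝ) → ℝ := fun j z s ↦ e z s j
  have hV : ∀ s, IsCenteredGP (V s) (K s) P := by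
    rintro (_ | j)
    · exact hu_gp i
    · exact hA_gp i j j.2
  have hVm : ∀ s, Measurable fun p : Inp D × Ω ↦ V s p.1 p.2 := by
    rintro (_ | j)
    · exact hu i
    · exact hA i j
  have hind : iIndepFun (fun s ω x ↦ V s x ω) P := iIndepFun_rowProcess h_indep i
  have hH : Measurable H := measurable_past hresp i
  have hHV : IndepFun H (fun ω s x ↦ V s x ω) P :=
    indepFun_past_response hA hu hA_zero h_indep h_conv i
  have hy : ∀ j, Measurable fun p : Inp D × (Inp D → Set.Iio i → ℝ) ↦ y j p.1 p.2 := he.measurable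
  have hcongr : ∀ x, ∀ᵐ ω ∂P, (fun z ↦ ∑ j : Set.Iio i, Ahat (x - z) ω i j * response Ahat u z ω j)
      =ᵐ[volume] fun z ↦ ∑ j, V (some j) (x - z) ω * y j z (H ω) := by
    intro x
    filter_upwards [he.ae_ae_eq hresp] with ω hω
    filter_upwards [hω] with z hz
    exact Finset.sum_congr rfl fun j _ ↦ congrArg (Ahat (x - z) ω i j * ·) (hz j)
  have hint : ∀ x, ∀ᵐ ω ∂P, Integrable fun z ↦ ∑ j, V (some j) (x - z) ω * y j z (H ω) := by
    intro x
    filter_upwards [response_ae_eq hA_zero h_conv x, hcongr x] with ω h1 h2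
    exact (h1 i).1.congr h2
  have hf : ∀ x, ∀ᵐ ω ∂P, response Ahat u x ω i
      = V none x ω + ∫ z, ∑ j, V (some j) (x - z) ω * y j z (H ω) := by
    intro x
    filter_upwards [response_ae_eq hA_zero h_conv x, hcongr x] with ω h1 h2
    rw [(h1 i).2, integral_congr_ae h2]
    rfl
  rw [RowCondition, condition_iff_charPi (hu_gp i).kernel_comm
    (fun j hj ↦ (hA_gp i j hj).measurable_kernel (hA i j))
    (fun j hj ↦ (hA_gp i j hj).kernel_comm) hresp he]
  refine ⟨fun x x' ↦ ?_, fun I ↦ ?_⟩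
  · filter_upwards [ae_lintegral_eLpNorm_lt_top hV hVm hind hH hHV hy x (hint x),
      ae_lintegral_eLpNorm_lt_top hV hVm hind hH hHV hy x' (hint x')] with s h1 h2 j
    have hm := fun x ↦ measurable_convolution_integrand (y := fun r z ↦ r.elim 0 fun j ↦ y j z s)
      hVm (by
        rintro (_ | j)
        · exact measurable_const
        · exact (hy j).comp measurable_prodMk_right) (some j) x
    refine (integrable_covariance_prod (hm x) (hm x') (h1 j) (h2 j)).congr
      (Filter.Eventually.of_forall fun p ↦ ?_)
    have h3 := (hV (some j)).integral_mul_eq (x - p.1) (x' - p.2)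
    calc ∫ ω, V (some j) (x - p.1) ω * y j p.1 s * (V (some j) (x' - p.2) ω * y j p.2 s) ∂P
        = ∫ ω, V (some j) (x - p.1) ω * V (some j) (x' - p.2) ω * (y j p.1 s * y j p.2 s) ∂P := by
          congr 1
          ext ω
          ring
      _ = kernelIntegrand kA i j x (fun z ↦ e z s) x' (fun z ↦ e z s) p := by
          rw [integral_mul_const, h3, ← mul_assoc]
          rfl
  · exact ae_integral_exp_condDistrib_eq hV hVm hind hH hHV hy hint hf I

end Equivalence

end LinEquiv

end

theorem lemma2 {D M : ℕ}
    -- the latent processes `u` and `Â`, on a probability space `(Ω, P)`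
    {Ω : Type*} [MeasurableSpace Ω] (P : Measure Ω) [IsProbabilityMeasure P]
    (u : LinEquiv.Inp D → Ω → Fin M → ℝ)
    (Ahat : LinEquiv.Inp D → Ω → Matrix (Fin M) (Fin M) ℝ)
    (ku : Fin M → LinEquiv.Inp D → LinEquiv.Inp D → ℝ)
    (kA : Fin M → Fin M → LinEquiv.Inp D → LinEquiv.Inp D → ℝ)
    -- they are jointly measurable, so that integrals of sample paths make sense
    (hu_meas : ∀ i, Measurable (fun p : LinEquiv.Inp D × Ω => u p.1 p.2 i))
    (hA_meas : ∀ i j, Measurable (fun p : LinEquiv.Inp D × Ω => Ahat p.1 p.2 i j))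
    -- `u_i ∼ GP(0, k_{u_i})`, `Â_{i,j} ∼ GP(0, k_{Â_{i,j}})` for `i > j`, `Â_{i,j} = 0` otherwise
    (hu_gp : ∀ i, LinEquiv.IsCenteredGP (fun x ω => u x ω i) (ku i) P)
    (hA_gp : ∀ i j, j < i → LinEquiv.IsCenteredGP (fun x ω => Ahat x ω i j) (kA i j) P)
    (hA_zero : ∀ i j, i ≤ j → ∀ x ω, Ahat x ω i j = 0)
    -- all these processes are mutually independent
    (h_indep : iIndepFun
      (fun (s : Fin M ⊕ Fin M × Fin M) (ω : Ω) (x : LinEquiv.Inp D) =>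
        Sum.elim (fun i => u x ω i) (fun q => Ahat x ω q.1 q.2) s) P)
    -- the convolution integrals defining `A^1 ∘ u, …, A^(M-1) ∘ u` exist almost surely
    (h_conv : ∀ x, ∀ᵐ ω ∂P, ∀ n : ℕ, n + 1 < M →
      Integrable (fun z => Ahat (x - z) ω *ᵥ
        ((LinEquiv.PathMap.conv (fun x' => Ahat x' ω)).pow n).act (fun x' => u x' ω) z))
    -- the modelled process `g`, on a probability space `(Ω', P')`
    {Ω' : Type*} [MeasurableSpace Ω'] (P' : Measure Ω') [IsProbabilityMeasure P']
    (g : LinEquiv.Inp D → Ω' → Fin M → ℝ)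
    (hg_meas : ∀ i, Measurable (fun p : LinEquiv.Inp D × Ω' => g p.1 p.2 i)) :
    -- `g` is distributed as `(∑_{n=0}^{M-1} A^n) ∘ u`
    IdentDistrib (fun ω x => g x ω)
      (fun ω => LinEquiv.PathMap.act
        (∑ n ∈ Finset.range M, (LinEquiv.PathMap.conv (fun x => Ahat x ω)).pow n)
        (fun x => u x ω)) P' P ↔
    -- the kernels exist, and `g_i | g_{1:i-1} ∼ GP(0, k_{u_i} + k_{A_i}(·, g_{1:i-1}, ·, g_{1:i-1}))`
    ∀ i : Fin M,
      (∀ x x', ∀ᵐ ω ∂P', ∀ j : Set.Iio i,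
        Integrable (LinEquiv.kernelIntegrand kA i j
          x (LinEquiv.past i (fun z => g z ω)) x' (LinEquiv.past i (fun z => g z ω)))
          (volume.prod volume)) ∧
      LinEquiv.IsCondCenteredGP (fun x ω => g x ω i)
        (fun ω => LinEquiv.past i (fun x => g x ω))
        (fun y x x' => ku i x x' + LinEquiv.kernelA kA i x y x' y) P' := by
  have hresp := LinEquiv.measurable_response hA_meas hu_meas
  have hresp' : ∀ i, Measurable fun p : LinEquiv.Inp D × Ω => LinEquiv.response Ahat u p.1 p.2 i :=
    fun i => (measurable_pi_apply i).comp hresp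
  have hku := fun i => (hu_gp i).kernel_comm
  have hkA := fun i j hj => (hA_gp i j hj).measurable_kernel (hA_meas i j)
  have hkA' := fun i j hj => (hA_gp i j hj).kernel_comm
  have hrow := LinEquiv.rowCondition_response hu_meas hA_meas hu_gp hA_gp hA_zero h_indep h_conv
  constructor
  · intro h i
    exact (hrow i).of_map_eq (hku i) (hkA i) (hkA' i) hresp' hg_meas h.map_eq
  · intro h
    exact ⟨(LinEquiv.measurable_path hg_meas).aemeasurable,
      (LinEquiv.measurable_path hresp').aemeasurable,
      LinEquiv.map_eq_of_rowCondition hku hkA hkA' hresp' hg_meas hrow h⟩
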